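/- Notation. Let $e_1=(1,1)$, $e_2=(-1,1)$. White vertices are the $x=(x_1,x_2)\in\mathbb Z^2$ with $x_1$ odd and $x_2$ even; black vertices are the $y=(y_1,y_2)\in\mathbb Z^2$ with $y_1$ even and $y_2$ odd. For $\varepsilon\in\{0,1\}$ let $\mathtt W_\varepsilon$ and $\mathtt B_\varepsilon$ be the sets of white, respectively black, vertices whose coordinate sum is congruent to $2\varepsilon+1$ modulo $4$. A fundamental domain is a set $\{\mathbf u,\mathbf u+e_1,\mathbf u+e_2,\mathbf u+e_1+e_2\}$ with $\mathbf u\in\mathtt W_0$. For $0<a<1$ put $$\mathcal K_a(z,w)=\begin{pmatrix} i(a+w^{-1}) & a+z\\ a+z^{-1} & i(a+w)\end{pmatrix},$$ with rows and columns indexed by $0,1$. The whole-plane inverse Kasteleyn matrix with edge weights $a$ and $1$ and zero magnetic field is defined, for $\mathbf w\in \mathtt W_{\varepsilon_1}$ and $\mathbf b\in \mathtt B_{\varepsilon_2}$ in the same fundamental domain and $u,v\in\mathbb Z$, by $$\mathbb K_{a,0,0}^{-1}(\mathbf w,\mathbf b+2ue_1+2ve_2)=\frac1{(2\pi i)^2}\int_{|z|=1}\frac{dz}{z}\int_{|w|=1}\frac{dw}{w}\,\bigl(\mathcal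 K_a(z,w)^{-1}\bigr)_{\varepsilon_1\varepsilon_2}z^uw^v .$$ For $x$ white and $y$ black let $\zeta(x,y)=(-1)^{(y_2-x_1)/2}$, and let $\Sigma(x,y)=1$ if $y-x=pe_1+qe_2$ with $p$ odd and $q$ even, and $\Sigma(x,y)=i$ if $y-x=pe_1+qe_2$ with $p$ even and $q$ odd (exactly one of these holds). For $-1\le z\le -3+2\sqrt2$ let $$\theta(z)=\frac1{2z}\Bigl(i\sqrt{4z^2-(4z+z^2+1)^2}-(4z+z^2+1)\Bigr),\qquad k^{(v)}(z)=\frac{\theta(z)^v+\theta(z)^{-v}}2\in\mathbb R,$$ $$b(z)=-\frac12\log\left(\frac{4\sqrt2(1+z)}{1-z+\sqrt{-1-6z-z^2}}\right).$$ For $p$ odd and $q$ even let $$c_0(pe_1+qe_2)=\frac1\pi\int_{-1}^{-3+2\sqrt2}\frac{z^{(|p|-1)/2}k^{(q/2)}(z)}{\sqrt{-1-6z-z^2}}\,dz,\qquad c_1(pe_1+qe_2)=\frac1{2\pi},$$ $$c_2(pe_1+qe_2)=\frac{(-1)^{q/2}}\pi\left(\int_{-1}^{-3+2\sqrt2}\Bigl(\tfrac12(-z)^{(|p|-1)/2}+\sum_{i=0}^{(|p|-3)/2}(-z)^i\Bigr)\frac{k^{(q/2)}(z)}{\sqrt{-1-6z-z^2}}\,dz-\log2-\int_{-1}^{-3+2\sqrt2}\frac{dk^{(q/2)}}{dz}(z)\,b(z)\,dz\right),$$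 where the finite sum is empty for $|p|=1$; for $p$ even and $q$ odd let $c_i(pe_1+qe_2)=c_i(qe_1+pe_2)$, $i=0,1,2$. Theorem. Let $B>0$ be fixed and let $a=1-Bm^{-1/2}$, $m\in\mathbb N$. Then, as $m\to\infty$, for $x$ white and $y$ black, $$\mathbb K_{a,0,0}^{-1}(x,y)=\frac1{\Sigma(x,y)}\Bigl(c_0(y-x)+\tfrac12c_0(y-x)Bm^{-1/2}+\zeta(x,y)\bigl(c_1(y-x)Bm^{-1/2}\log(Bm^{-1/2})+c_2(y-x)Bm^{-1/2}\bigr)\Bigr)+O(m^{-1}\log m).$$ Precisely: for every $B>0$ and $R\in\mathbb N$ there is a constant $C$ such that for all sufficiently large $m$ and all white $x$ and black $y$ with $|y_1-x_1|\le R$ and $|y_2-x_2|\le R$, the absolute value of the difference between the left-hand side and the displayed main term on the right (without the error term) is at most $C\,m^{-1}\log m$. -/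

import Mathlib

open Filter

namespace TwoPeriodicAztec

noncomputable section

/-! The lattice of vertices, in the Euclidean coordinates of `ℤ × ℤ`. -/

/-- The vector `e₁ = (1, 1)`. -/
def e1 : ℤ × ℤ := (1, 1)

/-- The vector `e₂ = (-1, 1)`. -/
def e2 : ℤ × ℤ := (-1, 1)

/-- White vertices: first coordinate odd, second coordinate even. -/
def IsWhite (x : ℤ × ℤ) : Prop := Odd x.1 ∧ Even x.2

/-- Black vertices: first coordinate even, second coordinate odd. -/
def IsBlack (y : ℤ × ℤ) : Prop := Even y.1 ∧ Odd y.2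

/-- The class `W_ε`, `ε ∈ {0, 1}`, of white vertices. -/
def IsWhiteType (ε : Fin 2) (x : ℤ × ℤ) : Prop :=
  IsWhite x ∧ x.1 + x.2 ≡ 2 * (ε.val : ℤ) + 1 [ZMOD 4]

/-- The class `B_ε`, `ε ∈ {0, 1}`, of black vertices. -/
def IsBlackType (ε : Fin 2) (y : ℤ × ℤ) : Prop :=
  IsBlack y ∧ y.1 + y.2 ≡ 2 * (ε.val : ℤ) + 1 [ZMOD 4]

/-- The four vertices of the fundamental domain of a vertex `w ∈ W_0`. -/
def fundamentalDomain (w : ℤ × ℤ) : Set (ℤ × ℤ) :=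
  {w, w + e1, w + e2, w + e1 + e2}

/-- The index `ε` of a vertex: `0` if its coordinate sum is `1` modulo `4`, else `1`. -/
def vertexType (x : ℤ × ℤ) : Fin 2 := if (x.1 + x.2) % 4 = 1 then 0 else 1

/-- The vector from the white vertex of type `ε₁` to the black vertex of type `ε₂` inside one
fundamental domain. -/
def domainOffset (ε₁ ε₂ : Fin 2) : ℤ × ℤ := !![e2, e1; -e1, -e2] ε₁ ε₂

/-! The whole-plane inverse Kasteleyn matrix. -/

/-- The magnetically altered Kasteleyn matrix `𝒦_a(z, w)` of the fundamental domain
(rows: black vertices, columns: white vertices). -/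
def magneticKasteleyn (a : ℝ) (z w : ℂ) : Matrix (Fin 2) (Fin 2) ℂ :=
  !![Complex.I * (a + w⁻¹), a + z; a + z⁻¹, Complex.I * (a + w)]

/-- The double torus integral
`(2πi)⁻² ∫_{|z| = e^H} dz/z ∫_{|w| = e^V} dw/w (𝒦_a(z, w)⁻¹)_{ε₁ ε₂} z^u w^v`. -/
def torusIntegral (a H V : ℝ) (ε₁ ε₂ : Fin 2) (u v : ℤ) : ℂ :=
  1 / (2 * Real.pi * Complex.I) ^ 2 *
    ∮ z in C(0, Real.exp H), 1 / z *
      ∮ w in C(0, Real.exp V), 1 / w * ((magneticKasteleyn a z w)⁻¹ ε₁ ε₂ * z ^ u * w ^ v)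

/-- The entry at `(x, y)` (`x` white, `y` black) of the whole-plane inverse Kasteleyn matrix
`𝕂_{a,H,V}⁻¹` with edge weights `a` and `1` and magnetic field `(H, V)`. If `ε₁, ε₂` are the types
of `x, y`, then `y = b + 2 u e₁ + 2 v e₂` where `b` is the black vertex of type `ε₂` in the
fundamental domain of `x`; see `planeInverse_eq`. -/
def planeInverse (a H V : ℝ) (x y : ℤ × ℤ) : ℂ :=
  torusIntegral a H V (vertexType x) (vertexType y)
    (((y - x - domainOffset (vertexType x) (vertexType y)).1 +
      (y - x - domainOffset (vertexType x) (vertexType y)).2) / 4)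
    (((y - x - domainOffset (vertexType x) (vertexType y)).2 -
      (y - x - domainOffset (vertexType x) (vertexType y)).1) / 4)

theorem vertexType_eq {ε : Fin 2} {x : ℤ × ℤ}
    (h : x.1 + x.2 ≡ 2 * (ε.val : ℤ) + 1 [ZMOD 4]) : vertexType x = ε := by
  unfold vertexType
  unfold Int.ModEq at h
  fin_cases ε
  · simp at h ⊢
    omega
  · simp at h ⊢
    omega

/-- The characterisation of `planeInverse`: for `w ∈ W_{ε₁}` and `b ∈ B_{ε₂}` in the same
fundamental domain, the entry at `(w, b + 2 u e₁ + 2 v e₂)` is the double torus integral. -/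
theorem planeInverse_eq (a H V : ℝ) {ε₁ ε₂ : Fin 2} {w₀ w b : ℤ × ℤ} (hw₀ : IsWhiteType 0 w₀)
    (hw : IsWhiteType ε₁ w) (hb : IsBlackType ε₂ b) (hwd : w ∈ fundamentalDomain w₀)
    (hbd : b ∈ fundamentalDomain w₀) (u v : ℤ) :
    planeInverse a H V w (b + (2 * u) • e1 + (2 * v) • e2) =
      torusIntegral a H V ε₁ ε₂ u v := by
  have t1 : vertexType w = ε₁ := vertexType_eq hw.2
  have t2 : vertexType (b + (2 * u) • e1 + (2 * v) • e2) = ε₂ := by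
    apply vertexType_eq
    have h2 := hb.2
    unfold Int.ModEq at h2 ⊢
    simp [e1, e2]
    omega
  have key : b - w = domainOffset ε₁ ε₂ := by
    obtain ⟨p, q⟩ := w₀
    obtain ⟨w1, w2⟩ := w
    obtain ⟨b1, b2⟩ := b
    obtain ⟨⟨h1, h2⟩, h3⟩ := hw₀
    obtain ⟨⟨h4, h5⟩, h6⟩ := hw
    obtain ⟨⟨h7, h8⟩, h9⟩ := hb
    simp only [fundamentalDomain, e1, e2, Set.mem_insert_iff, Set.mem_singleton_iff,
      Prod.mk_add_mk, Prod.mk.injEq] at hwd hbd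
    unfold Int.ModEq at h3 h6 h9
    rw [Int.odd_iff] at h1 h4 h8
    rw [Int.even_iff] at h2 h5 h7
    fin_cases ε₁ <;> fin_cases ε₂ <;> simp [domainOffset, e1, e2] at * <;> omega
  unfold planeInverse
  rw [t1, t2]
  have hd : b + (2 * u) • e1 + (2 * v) • e2 - w - domainOffset ε₁ ε₂ =
      (2 * u) • e1 + (2 * v) • e2 := by
    rw [← key]; abel
  rw [hd]
  congr 1
  · simp [e1, e2]; omega
  · simp [e1, e2]; omega

/-! The sign `ζ` and the phase `Σ`. -/

/-- `ζ(x, y) = (-1)^((y₂ - x₁) / 2)`; for `x` white and `y` black the exponent is an integer. -/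
def zetaSign (x y : ℤ × ℤ) : ℝ := (-1 : ℝ) ^ ((y.2 - x.1) / 2)

open Classical in
/-- `Σ(x, y)` is `1` if `y = x + (2k+1) e₁ + 2l e₂`, and `i` if `y = x + 2k e₁ + (2l+1) e₂`
(for `x` white and `y` black exactly one of the two holds). -/
def sigmaPhase (x y : ℤ × ℤ) : ℂ :=
  if ∃ k l : ℤ, y = x + (2 * k + 1) • e1 + (2 * l) • e2 then 1
  else if ∃ k l : ℤ, y = x + (2 * k) • e1 + (2 * l + 1) • e2 then Complex.I
  else 0

/-! The coefficients `c₀, c₁, c₂`. -/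

/-- `θ(z) = (i √(4z² - (4z + z² + 1)²) - (4z + z² + 1)) / (2z)`. -/
def theta (z : ℝ) : ℂ :=
  1 / (2 * z) * (Complex.I * Real.sqrt (4 * z ^ 2 - (4 * z + z ^ 2 + 1) ^ 2) -
    (4 * z + z ^ 2 + 1))

/-- `k^{(v)}(z) = (θ(z)^v + θ(z)^{-v}) / 2`, which is real on `[-1, -3 + 2√2]`
(see `kFun_eq`). -/
def kFun (v : ℤ) (z : ℝ) : ℝ := ((theta z ^ v + theta z ^ (-v)) / 2).re

theorem theta_norm {z : ℝ} (hz : -1 ≤ z) (hz' : z ≤ -3 + 2 * Real.sqrt 2) :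
    theta z * starRingEnd ℂ (theta z) = 1 := by
  have hs : Real.sqrt 2 ^ 2 = 2 := Real.sq_sqrt (by norm_num)
  have hs0 : 0 ≤ Real.sqrt 2 := Real.sqrt_nonneg 2
  have hs1 : Real.sqrt 2 < 3 / 2 := by nlinarith
  have hz0 : z ≠ 0 := by intro h; nlinarith
  have h1 : 0 ≤ -1 - 6 * z - z ^ 2 := by
    nlinarith [mul_nonneg (sub_nonneg.2 hz') (by nlinarith : 0 ≤ z + 3 + 2 * Real.sqrt 2)]
  have hD : 0 ≤ 4 * z ^ 2 - (4 * z + z ^ 2 + 1) ^ 2 := by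
    nlinarith [mul_nonneg (sq_nonneg (1 + z)) h1]
  have hq : ((Real.sqrt (4 * z ^ 2 - (4 * z + z ^ 2 + 1) ^ 2) : ℝ) : ℂ) ^ 2 =
      4 * z ^ 2 - (4 * z + z ^ 2 + 1) ^ 2 := by
    rw [← Complex.ofReal_pow, Real.sq_sqrt hD]; push_cast; ring
  have hzc : (z : ℂ) ≠ 0 := by exact_mod_cast hz0
  unfold theta
  simp only [map_mul, map_sub, map_div₀, map_one, map_add, map_pow, Complex.conj_I,
    Complex.conj_ofReal, map_ofNat]
  generalize ((Real.sqrt (4 * z ^ 2 - (4 * z + z ^ 2 + 1) ^ 2) : ℝ) : ℂ) = s at hq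
  field_simp
  have hI : Complex.I ^ 2 = -1 := Complex.I_sq
  linear_combination hq - s ^ 2 * hI

/-- On `[-1, -3 + 2√2]` the real part in the definition of `kFun` changes nothing. -/
theorem kFun_eq (v : ℤ) {z : ℝ} (hz : -1 ≤ z) (hz' : z ≤ -3 + 2 * Real.sqrt 2) :
    (kFun v z : ℂ) = (theta z ^ v + theta z ^ (-v)) / 2 := by
  have h : starRingEnd ℂ (theta z) = (theta z)⁻¹ :=
    eq_inv_of_mul_eq_one_right (theta_norm hz hz')
  unfold kFun
  rw [← Complex.conj_eq_iff_re]
  simp only [map_div₀, map_add, map_zpow₀, map_ofNat, h, inv_zpow', neg_neg]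
  ring

/-- `b(z) = -(1/2) log (4√2 (1 + z) / (1 - z + √(-1 - 6z - z²)))`. -/
def bFun (z : ℝ) : ℝ :=
  -(1 / 2) * Real.log (4 * Real.sqrt 2 * (1 + z) / (1 - z + Real.sqrt (-1 - 6 * z - z ^ 2)))

/-- `c₀(p e₁ + q e₂)` for `p` odd and `q` even. -/
def c0Odd (p q : ℤ) : ℝ :=
  1 / Real.pi * ∫ z in (-1 : ℝ)..(-3 + 2 * Real.sqrt 2),
    z ^ ((p.natAbs - 1) / 2) * kFun (q / 2) z / Real.sqrt (-1 - 6 * z - z ^ 2)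

/-- `c₂(p e₁ + q e₂)` for `p` odd and `q` even; the finite sum runs over
`0 ≤ i ≤ (|p| - 3) / 2` and is empty for `|p| = 1`. -/
def c2Odd (p q : ℤ) : ℝ :=
  (-1 : ℝ) ^ (q / 2) / Real.pi *
    ((∫ z in (-1 : ℝ)..(-3 + 2 * Real.sqrt 2),
        (1 / 2 * (-z) ^ ((p.natAbs - 1) / 2) +
          ∑ i ∈ Finset.range ((p.natAbs - 1) / 2), (-z) ^ i) *
        (kFun (q / 2) z / Real.sqrt (-1 - 6 * z - z ^ 2)))
      - Real.log 2
      - ∫ z in (-1 : ℝ)..(-3 + 2 * Real.sqrt 2), deriv (kFun (q / 2)) z * bFun z)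

/-- The coordinate `p` of `d = p e₁ + q e₂`. -/
def coordP (d : ℤ × ℤ) : ℤ := (d.1 + d.2) / 2

/-- The coordinate `q` of `d = p e₁ + q e₂`. -/
def coordQ (d : ℤ × ℤ) : ℤ := (d.2 - d.1) / 2

theorem coord_eq (p q : ℤ) :
    coordP (p • e1 + q • e2) = p ∧ coordQ (p • e1 + q • e2) = q := by
  constructor
  · simp [coordP, e1, e2]; omega
  · simp [coordQ, e1, e2]; omega

/-- A function of `d = p e₁ + q e₂` given by `F p q` for `p` odd, `q` even and by `F q p` for
`p` even, `q` odd. -/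
def symmetrize (F : ℤ → ℤ → ℝ) (d : ℤ × ℤ) : ℝ :=
  if Odd (coordP d) ∧ Even (coordQ d) then F (coordP d) (coordQ d)
  else if Even (coordP d) ∧ Odd (coordQ d) then F (coordQ d) (coordP d)
  else 0

/-- The coefficient `c₀`. -/
def c0 : ℤ × ℤ → ℝ := symmetrize c0Odd

/-- The coefficient `c₁`. -/
def c1 : ℤ × ℤ → ℝ := symmetrize fun _ _ => 1 / (2 * Real.pi)

/-- The coefficient `c₂`. -/
def c2 : ℤ × ℤ → ℝ := symmetrize c2Odd

/-- The small parameter `h = B m^{-1/2}`. -/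
def smallParam (B : ℝ) (m : ℕ) : ℝ := B * (m : ℝ) ^ (-(1 / 2) : ℝ)

end

end TwoPeriodicAztec

open TwoPeriodicAztec

/-!
The entries of `𝒦_a(z, w)⁻¹` are affine functions of `z` or `w` divided by the symbol of a massive
lattice Laplacian of squared mass `(1 - a)² / (2a)`. Hence every entry of the inverse Kasteleyn
matrix is, up to the phase `Σ`, a combination `a G(k, l) + G(k + 1, l)` of Green functions at
neighbouring sites. Integrating out one variable by Poisson's formula leaves an integral over
an angle `β` of a power of the decaying root `r(β)` of a second order recursion. Since `G` carries
the sign `(-1) ^ (k + l)`, for `h = 1 - a → 0` the combination separates into the difference of two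
neighbouring values, which has a finite limit up to `O(h² log h)`, and `h` times their mean, which
diverges like `-(1/2) log h`; this mean produces both terms with the factor `ζ`. The substitution
`z = -r(β)` turns the limits into the integrals defining `c₀` and `c₂`, and an integration by parts
of the regularised mean gives rise to the function `b`.
-/

namespace TwoPeriodicAztec

open Asymptotics Real Set Topology

noncomputable section

/-- The root in `(0, 1)` of `r + r⁻¹ = 2 + 4 s²` for `s > 0`: the factor by which the
Green function of the Kasteleyn operator decays at a frequency with mass `s²`. The formula
`sinh² x = (cosh 2x - 1) / 2` is what makes `arsinh` appear. -/
def decayRoot (s : ℝ) : ℝ := exp (-2 * arsinh s)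

theorem decayRoot_pos (s : ℝ) : 0 < decayRoot s := exp_pos _

theorem decayRoot_zero : decayRoot 0 = 1 := by simp [decayRoot]

theorem decayRoot_le_one {s : ℝ} (hs : 0 ≤ s) : decayRoot s ≤ 1 :=
  exp_le_one_iff.2 (by linarith [arsinh_nonneg_iff.2 hs])

theorem decayRoot_lt_one {s : ℝ} (hs : 0 < s) : decayRoot s < 1 :=
  Real.exp_lt_one_iff.2 (by linarith [arsinh_pos_iff.2 hs])

theorem inv_decayRoot (s : ℝ) : (decayRoot s)⁻¹ = exp (2 * arsinh s) := by
  rw [decayRoot, ← exp_neg, neg_mul, neg_neg]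

theorem inv_decayRoot_add (s : ℝ) : (decayRoot s)⁻¹ + decayRoot s = 2 + 4 * s ^ 2 := by
  have h : (decayRoot s)⁻¹ + decayRoot s = 2 * cosh (2 * arsinh s) := by
    rw [inv_decayRoot, decayRoot, cosh_eq, neg_mul]; ring
  rw [h, cosh_two_mul, cosh_sq, sinh_arsinh]; ring

theorem inv_decayRoot_sub (s : ℝ) : (decayRoot s)⁻¹ - decayRoot s = 4 * s * √(1 + s ^ 2) := by
  have h : (decayRoot s)⁻¹ - decayRoot s = 2 * sinh (2 * arsinh s) := by
    rw [inv_decayRoot, decayRoot, sinh_eq, neg_mul]; ring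
  rw [h, sinh_two_mul, sinh_arsinh, cosh_arsinh]; ring

theorem one_sub_decayRoot (s : ℝ) : 1 - decayRoot s = 2 * s * exp (-arsinh s) := by
  have h : 2 * s = exp (arsinh s) - exp (-arsinh s) := by
    linarith [sinh_eq (arsinh s), sinh_arsinh s]
  rw [h, decayRoot, sub_mul, ← exp_add, ← exp_add, add_neg_cancel, exp_zero, ← two_mul,
    mul_neg, neg_mul]

theorem one_add_decayRoot (s : ℝ) :
    1 + decayRoot s = 2 * √(1 + s ^ 2) * exp (-arsinh s) := by
  have h : 2 * √(1 + s ^ 2) = exp (arsinh s) + exp (-arsinh s) := by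
    rw [← cosh_arsinh s, cosh_eq]; ring
  rw [h, decayRoot, add_mul, ← exp_add, ← exp_add, add_neg_cancel, exp_zero, ← two_mul,
    mul_neg, neg_mul]

theorem hasDerivAt_decayRoot (s : ℝ) :
    HasDerivAt decayRoot (-2 * decayRoot s / √(1 + s ^ 2)) s := by
  rw [show -2 * decayRoot s / √(1 + s ^ 2) = decayRoot s * (-2 * (√(1 + s ^ 2))⁻¹) by ring]
  exact ((hasDerivAt_arsinh s).const_mul (-2)).exp

theorem continuous_decayRoot : Continuous decayRoot :=
  continuous_iff_continuousAt.2 fun s => (hasDerivAt_decayRoot s).continuousAt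

theorem abs_decayRoot_sub_le {s t : ℝ} (hs : 0 ≤ s) (ht : 0 ≤ t) :
    |decayRoot t - decayRoot s| ≤ 2 * |t - s| := by
  refine (convex_Ici (0 : ℝ)).norm_image_sub_le_of_norm_hasDerivWithin_le
    (fun x _ => (hasDerivAt_decayRoot x).hasDerivWithinAt) (fun x hx => ?_) hs ht
  have hroot : 1 ≤ √(1 + x ^ 2) := one_le_sqrt.2 (by nlinarith)
  rw [norm_div, norm_mul, norm_of_nonneg (decayRoot_pos x).le,
    norm_of_nonneg (sqrt_nonneg _), div_le_iff₀ (by linarith)]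
  norm_num
  linarith [decayRoot_le_one hx]

theorem norm_add_decayRoot_sq {w : ℂ} (hw : ‖w‖ = 1) (s : ℝ) :
    ((‖w + decayRoot s‖ ^ 2 : ℝ) : ℂ) = decayRoot s * (2 + 4 * s ^ 2 + (w + w⁻¹)) := by
  have hw0 : w ≠ 0 := norm_ne_zero_iff.1 (by simp [hw])
  have hr0 : (decayRoot s : ℂ) ≠ 0 := by exact_mod_cast (decayRoot_pos s).ne'
  have hsum : (2 + 4 * s ^ 2 : ℂ) = (decayRoot s : ℂ)⁻¹ + decayRoot s := by
    exact_mod_cast (inv_decayRoot_add s).symm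
  rw [hsum, Complex.ofReal_pow, ← Complex.mul_conj', map_add, Complex.conj_ofReal,
    ← Complex.inv_eq_conj hw]
  field_simp
  ring

/-- By `norm_add_decayRoot_sq` this is Poisson's formula for `w ^ n` at the point `-r`. -/
theorem circleAverage_pow_div {s : ℝ} (hs : 0 < s) (n : ℕ) :
    circleAverage (fun w : ℂ => w ^ n / (2 + 4 * s ^ 2 + (w + w⁻¹))) 0 1 =
      (-decayRoot s : ℂ) ^ n / (4 * s * √(1 + s ^ 2) : ℝ) := by
  set r := decayRoot s with hr
  have hr0 : 0 < r := decayRoot_pos s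
  have hgap : (r⁻¹ - r : ℝ) ≠ 0 := by rw [inv_decayRoot_sub]; positivity
  have hpoisson := DiffContOnCl.circleAverage_poissonKernel_smul (c := 0) (w := -(r : ℂ))
    (R := 1) (f := fun w : ℂ => w ^ n) (by fun_prop : Differentiable ℂ _).diffContOnCl
    (by simpa [abs_of_pos hr0] using decayRoot_lt_one hs)
  have hkernel : EqOn (poissonKernel 0 (-(r : ℂ)) • fun w : ℂ => w ^ n)
      (fun w => (r⁻¹ - r) • (w ^ n / (2 + 4 * s ^ 2 + (w + w⁻¹)))) (Metric.sphere 0 |1|) := by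
    intro w hw
    have hw1 : ‖w‖ = 1 := by simpa using hw
    have hrc : (r : ℂ) ≠ 0 := by exact_mod_cast hr0.ne'
    simp only [Pi.smul_apply', poissonKernel_def, sub_zero, sub_neg_eq_add, norm_neg, hw1,
      Complex.real_smul, Complex.ofReal_div, hr, norm_add_decayRoot_sq hw1]
    rw [← hr, Complex.norm_of_nonneg hr0.le]
    push_cast
    field_simp
  rw [circleAverage_congr_sphere hkernel, circleAverage_fun_smul, Complex.real_smul] at hpoisson
  rw [← inv_decayRoot_sub, ← hpoisson, mul_div_cancel_left₀ _ (by exact_mod_cast hgap)]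

theorem circleAverage_zpow_div {s : ℝ} (hs : 0 < s) (n : ℤ) :
    circleAverage (fun w : ℂ => w ^ n / (2 + 4 * s ^ 2 + (w + w⁻¹))) 0 1 =
      (-decayRoot s : ℂ) ^ n.natAbs / (4 * s * √(1 + s ^ 2) : ℝ) := by
  rw [← circleAverage_pow_div hs]
  obtain ⟨k, rfl | rfl⟩ := Int.eq_nat_or_neg n
  · simp
  · rw [← circleAverage_zero_one_congr_inv]
    simp [add_comm]

theorem continuous_uncurry_comp_circleMap {E : Type*} [TopologicalSpace E]
    {f : ℂ → ℂ → E} {c d : ℂ} {R S : ℝ}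
    (hf : ContinuousOn (Function.uncurry f) (Metric.sphere c |R| ×ˢ Metric.sphere d |S|)) :
    Continuous (Function.uncurry fun α β => f (circleMap c R α) (circleMap d S β)) :=
  hf.comp_continuous
    (((continuous_circleMap c R).comp continuous_fst).prodMk
      ((continuous_circleMap d S).comp continuous_snd)) fun _ =>
    ⟨circleMap_mem_sphere' _ _ _, circleMap_mem_sphere' _ _ _⟩

section IteratedCircleAverage

variable {E : Type*} [NormedAddCommGroup E] {f : ℂ → ℂ → E} {c d : ℂ} {R S : ℝ}

theorem circleIntegrable_right
    (hf : ContinuousOn (Function.uncurry f) (Metric.sphere c |R| ×ˢ Metric.sphere d |S|)) {z : ℂ}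
    (hz : z ∈ Metric.sphere c |R|) : CircleIntegrable (f z) d S :=
  ContinuousOn.circleIntegrable' <|
    hf.comp (continuousOn_const.prodMk continuousOn_id) fun _ hw => ⟨hz, hw⟩

variable [NormedSpace ℝ E]

theorem circleIntegrable_circleAverage
    (hf : ContinuousOn (Function.uncurry f) (Metric.sphere c |R| ×ˢ Metric.sphere d |S|)) :
    CircleIntegrable (fun z => circleAverage (f z) d S) c R :=
  ((intervalIntegral.continuous_parametric_intervalIntegral_of_continuous'
    (continuous_uncurry_comp_circleMap hf) 0 (2 * π)).const_smul (2 * π)⁻¹).intervalIntegrable _ _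

theorem circleAverage_circleAverage_add {g : ℂ → ℂ → E}
    (hf : ContinuousOn (Function.uncurry f) (Metric.sphere c |R| ×ˢ Metric.sphere d |S|))
    (hg : ContinuousOn (Function.uncurry g) (Metric.sphere c |R| ×ˢ Metric.sphere d |S|)) :
    circleAverage (fun z => circleAverage (fun w => f z w + g z w) d S) c R =
      circleAverage (fun z => circleAverage (f z) d S) c R +
        circleAverage (fun z => circleAverage (g z) d S) c R := by
  rw [← circleAverage_fun_add (circleIntegrable_circleAverage hf)
    (circleIntegrable_circleAverage hg)]
  exact circleAverage_congr_sphere fun z hz =>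
    circleAverage_fun_add (circleIntegrable_right hf hz) (circleIntegrable_right hg hz)

theorem circleAverage_swap
    (hf : ContinuousOn (Function.uncurry f) (Metric.sphere c |R| ×ˢ Metric.sphere d |S|)) :
    circleAverage (fun z => circleAverage (f z) d S) c R =
      circleAverage (fun w => circleAverage (fun z => f z w) c R) d S := by
  simp only [circleAverage_def, intervalIntegral.integral_smul]
  rw [MeasureTheory.intervalIntegral_intervalIntegral_swap]
  exact ((continuous_uncurry_comp_circleMap hf).continuousOn.integrableOn_compact
    (isCompact_uIcc.prod isCompact_uIcc)).mono_set
    (prod_mono uIoc_subset_uIcc uIoc_subset_uIcc)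

end IteratedCircleAverage

theorem circleMap_zpow_add_inv (v : ℤ) (β : ℝ) :
    circleMap 0 1 β ^ v + (circleMap 0 1 β)⁻¹ ^ v = ((2 * cos (v * β) : ℝ) : ℂ) := by
  have h : ∀ n : ℤ, circleMap 0 1 β ^ n = Complex.exp ((n * β : ℝ) * Complex.I) := fun n => by
    simp [circleMap, ← Complex.exp_int_mul, mul_assoc]
  rw [inv_zpow', h, h]
  push_cast
  rw [Complex.two_cos]
  ring_nf

theorem circleAverage_zero_one_eq_integral_add_inv {E : Type*} [NormedAddCommGroup E]
    [NormedSpace ℝ E] {f : ℂ → E} (hf : CircleIntegrable f 0 1) :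
    circleAverage f 0 1 =
      (2 * π)⁻¹ • ∫ β in 0..π, (f (circleMap 0 1 β) + f (circleMap 0 1 β)⁻¹) := by
  have hreflect : ∀ β, f (circleMap 0 1 (2 * π - β)) = f (circleMap 0 1 β)⁻¹ := fun β => by
    rw [circleMap_zero_inv, inv_one, sub_eq_neg_add, periodic_circleMap]
  have hsub : uIcc 0 π ⊆ uIcc 0 (2 * π) := by
    rw [uIcc_of_le pi_pos.le, uIcc_of_le two_pi_pos.le]
    exact Icc_subset_Icc_right (by linarith [pi_pos])
  have hsub' : uIcc π (2 * π) ⊆ uIcc 0 (2 * π) := by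
    rw [uIcc_of_le (by linarith [pi_pos]), uIcc_of_le two_pi_pos.le]
    exact Icc_subset_Icc_left pi_pos.le
  have hleft := IntervalIntegrable.mono_set hf hsub
  have hright := IntervalIntegrable.mono_set hf hsub'
  have hright' := (hright.comp_sub_left (2 * π)).symm
  simp only [hreflect, sub_self, show 2 * π - π = π by ring] at hright'
  rw [circleAverage_def, ← intervalIntegral.integral_add_adjacent_intervals hleft hright,
    intervalIntegral.integral_add hleft hright', ← intervalIntegral.integral_congr
      fun β _ => hreflect β, intervalIntegral.integral_comp_sub_left
      (fun β => f (circleMap 0 1 β)), sub_zero, show 2 * π - π = π by ring]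

theorem circleIntegrable_zpow_mul_ofReal {F : ℝ → ℝ} (hF : ContinuousOn F (Icc (-1) 1)) (v : ℤ) :
    CircleIntegrable (fun w : ℂ => w ^ v * F w.re) 0 1 := by
  refine (ContinuousOn.mul (fun w hw => ?_) ?_).circleIntegrable zero_le_one
  · have hw0 : w ≠ 0 := norm_ne_zero_iff.1 (by simp [mem_sphere_zero_iff_norm.1 hw])
    exact (continuousAt_zpow₀ w v (Or.inl hw0)).continuousWithinAt
  · refine Complex.continuous_ofReal.comp_continuousOn
      (hF.comp Complex.continuous_re.continuousOn fun w hw => abs_le.1 ?_)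
    exact (Complex.abs_re_le_norm w).trans (mem_sphere_zero_iff_norm.1 hw).le

theorem circleAverage_zpow_mul_ofReal {F : ℝ → ℝ} (hF : ContinuousOn F (Icc (-1) 1)) (v : ℤ) :
    circleAverage (fun w : ℂ => w ^ v * F w.re) 0 1 =
      ((1 / π * ∫ β in 0..π, cos (v * β) * F (cos β) : ℝ) : ℂ) := by
  have hpair : ∀ β, circleMap 0 1 β ^ v * F (circleMap 0 1 β).re +
      (circleMap 0 1 β)⁻¹ ^ v * F ((circleMap 0 1 β)⁻¹).re =
      ((2 * (cos (v * β) * F (cos β)) : ℝ) : ℂ) := fun β => by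
    have hre : ((circleMap 0 1 β)⁻¹).re = cos β := by
      rw [circleMap_zero_inv, circleMap_zero_re, cos_neg, inv_one, one_mul]
    rw [hre, circleMap_zero_re, one_mul, ← add_mul, circleMap_zpow_add_inv,
      ← Complex.ofReal_mul, mul_assoc]
  rw [circleAverage_zero_one_eq_integral_add_inv (circleIntegrable_zpow_mul_ofReal hF v)]
  simp only [hpair]
  rw [intervalIntegral.integral_ofReal, intervalIntegral.integral_const_mul, Complex.real_smul]
  push_cast
  field_simp

/-- The characteristic polynomial `-det 𝒦_a(z, w)` of the dimer model, as a function on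
`(ℂ \ {0})²`. -/
def kasteleynSymbol (a : ℝ) (z w : ℂ) : ℂ := 2 * (1 + a ^ 2) + a * (z + z⁻¹ + (w + w⁻¹))

/-- The Fourier coefficient of index `(u, v)` of `1 / kasteleynSymbol` on the unit torus. -/
def latticeGreen (a : ℝ) (u v : ℤ) : ℂ :=
  circleAverage (fun z => circleAverage (fun w => z ^ u * w ^ v / kasteleynSymbol a z w) 0 1) 0 1

/-- The squared mass for which `kasteleynSymbol a z w` is proportional to the symbol
`2 + 4 * mass a + (z + z⁻¹ + w + w⁻¹ + 2)` of a massive lattice Laplacian. -/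
def mass (a : ℝ) : ℝ := (1 - a) ^ 2 / (2 * a)

/-- The decaying solution `rⁿ / (r⁻¹ - r)` of the one-dimensional recursion
`x (n + 1) + x (n - 1) = (2 + 4 s²) x n`; see `inv_decayRoot_sub`. -/
def greenKernel (n : ℕ) (s : ℝ) : ℝ := decayRoot s ^ n / (4 * s * √(1 + s ^ 2))

/-- The frequency `√(sin² (β / 2) + δ)` at angle `β` for the squared mass `δ`. -/
def dispersion (δ β : ℝ) : ℝ := √(sin (β / 2) ^ 2 + δ)

/-- The partially transformed Green function: the coordinate conjugate to `β` is transformed back,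
the other one has been integrated out. -/
def massiveGreen (δ : ℝ) (n : ℕ) (v : ℤ) : ℝ :=
  ∫ β in 0..π, cos (v * β) * greenKernel n (dispersion δ β)

theorem mass_pos {a : ℝ} (ha : 0 < a) (ha' : a < 1) : 0 < mass a :=
  div_pos (pow_pos (by linarith) 2) (by linarith)

theorem ne_zero_of_mem_unitSphere {z : ℂ} (hz : z ∈ Metric.sphere (0 : ℂ) |1|) : z ≠ 0 :=
  ne_zero_of_mem_sphere (by simp) ⟨z, hz⟩

theorem add_inv_of_norm_eq_one {z : ℂ} (hz : ‖z‖ = 1) : z + z⁻¹ = ((2 * z.re : ℝ) : ℂ) := by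
  rw [Complex.inv_eq_conj hz, Complex.add_conj]

theorem kasteleynSymbol_ne_zero {a : ℝ} (ha : 0 < a) (ha' : a < 1) {z w : ℂ} (hz : ‖z‖ = 1)
    (hw : ‖w‖ = 1) : kasteleynSymbol a z w ≠ 0 := by
  have hz' := (abs_le.1 ((Complex.abs_re_le_norm z).trans hz.le)).1
  have hw' := (abs_le.1 ((Complex.abs_re_le_norm w).trans hw.le)).1
  have hpos : 0 < 2 * (1 + a ^ 2) + a * (2 * z.re + 2 * w.re) := by
    have : 0 < (1 - a) ^ 2 := pow_pos (by linarith) 2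
    nlinarith
  rw [kasteleynSymbol, add_inv_of_norm_eq_one hz, add_inv_of_norm_eq_one hw]
  exact_mod_cast hpos.ne'

theorem continuousOn_zpow_mul_zpow_div_kasteleynSymbol {a : ℝ} (ha : 0 < a) (ha' : a < 1)
    (u v : ℤ) :
    ContinuousOn (Function.uncurry fun z w : ℂ => z ^ u * w ^ v / kasteleynSymbol a z w)
      (Metric.sphere 0 |1| ×ˢ Metric.sphere 0 |1|) := by
  rintro ⟨z, w⟩ ⟨hz, hw⟩
  have hz0 : z ≠ 0 := ne_zero_of_mem_unitSphere hz
  have hw0 : w ≠ 0 := ne_zero_of_mem_unitSphere hw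
  have hsymbol := kasteleynSymbol_ne_zero ha ha' (z := z) (w := w) (by simpa using hz)
    (by simpa using hw)
  unfold kasteleynSymbol at hsymbol
  simp only [Function.uncurry_def, kasteleynSymbol]
  refine ContinuousAt.continuousWithinAt ?_
  fun_prop (disch := simp_all)

theorem latticeGreen_swap {a : ℝ} (ha : 0 < a) (ha' : a < 1) (u v : ℤ) :
    latticeGreen a u v = latticeGreen a v u := by
  rw [latticeGreen, circleAverage_swap (continuousOn_zpow_mul_zpow_div_kasteleynSymbol ha ha' u v)]
  simp only [latticeGreen, kasteleynSymbol, mul_comm, add_comm]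

theorem kasteleynSymbol_eq {a : ℝ} (ha : 0 < a) {z : ℂ} (hz : ‖z‖ = 1) (w : ℂ) :
    kasteleynSymbol a z w =
      a * (2 + 4 * (√((1 + z.re) / 2 + mass a) : ℝ) ^ 2 + (w + w⁻¹)) := by
  have hre := (abs_le.1 ((Complex.abs_re_le_norm z).trans hz.le)).1
  have hnonneg : 0 ≤ (1 + z.re) / 2 + mass a :=
    add_nonneg (by linarith) (div_nonneg (sq_nonneg _) (by linarith))
  have hac : (a : ℂ) ≠ 0 := by exact_mod_cast ha.ne'
  rw [← Complex.ofReal_pow, sq_sqrt hnonneg, kasteleynSymbol, add_inv_of_norm_eq_one hz, mass]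
  push_cast
  field_simp
  ring

theorem circleAverage_zpow_div_kasteleynSymbol {a : ℝ} (ha : 0 < a) (ha' : a < 1) {z : ℂ}
    (hz : ‖z‖ = 1) (n : ℤ) :
    circleAverage (fun w => w ^ n / kasteleynSymbol a z w) 0 1 =
      (((-1) ^ n / a * greenKernel n.natAbs √((1 + z.re) / 2 + mass a) : ℝ) : ℂ) := by
  have hre := (abs_le.1 ((Complex.abs_re_le_norm z).trans hz.le)).1
  have hsqrt : 0 < √((1 + z.re) / 2 + mass a) :=
    sqrt_pos.2 (add_pos_of_nonneg_of_pos (by linarith) (mass_pos ha ha'))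
  have hscale : (fun w => w ^ n / kasteleynSymbol a z w) = fun w : ℂ => a⁻¹ •
      (w ^ n / (2 + 4 * (√((1 + z.re) / 2 + mass a) : ℝ) ^ 2 + (w + w⁻¹))) := by
    ext w
    rw [kasteleynSymbol_eq ha hz, Complex.real_smul, Complex.ofReal_inv, ← div_eq_inv_mul, div_div,
      mul_comm (a : ℂ)]
  have hsign : (-1 : ℂ) ^ n.natAbs = (-1) ^ n := by
    obtain ⟨k, rfl | rfl⟩ := Int.eq_nat_or_neg n
    · simp
    · simp [← inv_pow]
  rw [hscale, circleAverage_fun_smul, circleAverage_zpow_div hsqrt, Complex.real_smul,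
    greenKernel, neg_pow, hsign]
  push_cast
  ring

theorem integral_cos_mul_comp_cos (F : ℝ → ℝ) (v : ℤ) :
    ∫ β in 0..π, cos (v * β) * F (cos β) = (-1) ^ v * ∫ β in 0..π, cos (v * β) * F (-cos β) := by
  have hsub := intervalIntegral.integral_comp_sub_left (a := 0) (b := π)
    (fun β => cos (v * β) * F (cos β)) π
  rw [sub_self, sub_zero] at hsub
  rw [← hsub, ← intervalIntegral.integral_const_mul]
  simp only [mul_sub, cos_int_mul_pi_sub, cos_pi_sub, mul_assoc]

theorem latticeGreen_eq {a : ℝ} (ha : 0 < a) (ha' : a < 1) (u v : ℤ) :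
    latticeGreen a u v =
      ((1 / (a * π) * ((-1) ^ (u + v) * massiveGreen (mass a) u.natAbs v) : ℝ) : ℂ) := by
  set F : ℝ → ℝ := fun x => greenKernel u.natAbs √((1 + x) / 2 + mass a) with hF
  have hcont : ContinuousOn F (Icc (-1) 1) := by
    refine ContinuousOn.div ?_ (by fun_prop) fun x hx => ?_
    · exact ((continuous_decayRoot.comp (by fun_prop)).pow _).continuousOn
    · have : 0 < √((1 + x) / 2 + mass a) :=
        sqrt_pos.2 (add_pos_of_nonneg_of_pos (by linarith [hx.1]) (mass_pos ha ha'))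
      positivity
  have hinner : EqOn
      (fun z => circleAverage (fun w => z ^ v * w ^ u / kasteleynSymbol a z w) 0 1)
      (fun z => ((-1) ^ u / a : ℝ) • (z ^ v * F z.re)) (Metric.sphere 0 |1|) := by
    intro z hz
    have h := circleAverage_fun_smul (a := z ^ v) (c := 0) (R := 1)
      (f := fun w => w ^ u / kasteleynSymbol a z w)
    rw [circleAverage_zpow_div_kasteleynSymbol ha ha' (by simpa using hz)] at h
    simp only [mul_div_assoc, smul_eq_mul] at h ⊢
    rw [h, hF, Complex.real_smul]
    push_cast
    ring
  have hmassive : ∫ β in 0..π, cos (v * β) * F (-cos β) = massiveGreen (mass a) u.natAbs v := by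
    refine intervalIntegral.integral_congr fun β _ => ?_
    simp only [hF, dispersion, sin_sq_eq_half_sub, mul_div_cancel₀ β (two_ne_zero' ℝ)]
    ring_nf
  rw [latticeGreen_swap ha ha', latticeGreen, circleAverage_congr_sphere hinner,
    circleAverage_fun_smul, circleAverage_zpow_mul_ofReal hcont,
    integral_cos_mul_comp_cos, hmassive, Complex.real_smul, ← Complex.ofReal_mul,
    zpow_add₀ (by norm_num)]
  congr 1
  field_simp

theorem latticeGreen_neg_left {a : ℝ} (ha : 0 < a) (ha' : a < 1) (u v : ℤ) :
    latticeGreen a (-u) v = latticeGreen a u v := by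
  rw [latticeGreen_eq ha ha', latticeGreen_eq ha ha', Int.natAbs_neg, zpow_add₀ (by norm_num),
    zpow_add₀ (by norm_num), zpow_neg, ← inv_zpow, inv_neg_one]

theorem torusIntegral_eq_circleAverage (a : ℝ) (ε₁ ε₂ : Fin 2) (u v : ℤ) :
    torusIntegral a 0 0 ε₁ ε₂ u v = circleAverage (fun z => circleAverage
      (fun w => (magneticKasteleyn a z w)⁻¹ ε₁ ε₂ * z ^ u * w ^ v) 0 1) 0 1 := by
  simp only [circleAverage_eq_circleIntegral one_ne_zero, torusIntegral, exp_zero, sub_zero,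
    smul_eq_mul, one_div]
  rw [← circleIntegral.integral_const_mul, ← circleIntegral.integral_const_mul]
  congr 1
  ext z
  ring

theorem inv_magneticKasteleyn {a : ℝ} {z w : ℂ} (hz : z ≠ 0) (hw : w ≠ 0) :
    (magneticKasteleyn a z w)⁻¹ = (-(kasteleynSymbol a z w)⁻¹) •
      !![Complex.I * (a + w), -(a + z); -(a + z⁻¹), Complex.I * (a + w⁻¹)] := by
  have hdet : (magneticKasteleyn a z w).det = -kasteleynSymbol a z w := by
    rw [magneticKasteleyn, Matrix.det_fin_two_of, kasteleynSymbol]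
    field_simp
    linear_combination (a * w + 1) * (a + w) * z * Complex.I_sq
  rw [Matrix.inv_def, hdet, Ring.inverse_eq_inv', inv_neg]
  simp [magneticKasteleyn, Matrix.adjugate_fin_two_of]

theorem torusIntegral_eq_latticeGreen {a : ℝ} (ha : 0 < a) (ha' : a < 1) {ε₁ ε₂ : Fin 2}
    {c : ℂ} {u v u' v' : ℤ}
    (hentry : ∀ z w : ℂ, z ≠ 0 → w ≠ 0 →
      (magneticKasteleyn a z w)⁻¹ ε₁ ε₂ * z ^ u * w ^ v =
        c * (a * (z ^ u * w ^ v / kasteleynSymbol a z w) +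
          z ^ u' * w ^ v' / kasteleynSymbol a z w)) :
    torusIntegral a 0 0 ε₁ ε₂ u v = c * (a * latticeGreen a u v + latticeGreen a u' v') := by
  have hcont (k : ℂ) (p q : ℤ) : ContinuousOn
      (Function.uncurry fun z w : ℂ => k • (z ^ p * w ^ q / kasteleynSymbol a z w))
      (Metric.sphere 0 |1| ×ˢ Metric.sphere 0 |1|) :=
    (continuousOn_zpow_mul_zpow_div_kasteleynSymbol ha ha' p q).const_smul k
  have hsplit : circleAverage (fun z => circleAverage
      (fun w => (magneticKasteleyn a z w)⁻¹ ε₁ ε₂ * z ^ u * w ^ v) 0 1) 0 1 =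
      circleAverage (fun z => circleAverage (fun w =>
        (c * a) • (z ^ u * w ^ v / kasteleynSymbol a z w) +
          c • (z ^ u' * w ^ v' / kasteleynSymbol a z w)) 0 1) 0 1 :=
    circleAverage_congr_sphere fun z hz => circleAverage_congr_sphere fun w hw =>
      (hentry z w (ne_zero_of_mem_unitSphere hz) (ne_zero_of_mem_unitSphere hw)).trans
        (by simp only [smul_eq_mul]; ring)
  rw [torusIntegral_eq_circleAverage, hsplit,
    circleAverage_circleAverage_add (hcont _ _ _) (hcont _ _ _)]
  simp only [circleAverage_fun_smul]
  simp only [smul_eq_mul, latticeGreen]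
  ring

/-- The combination of neighbouring Green functions to which, up to the phase `Σ`, every entry of
the inverse Kasteleyn matrix reduces. -/
def latticeEntry (a : ℝ) (k l : ℤ) : ℂ := a * latticeGreen a k l + latticeGreen a (k + 1) l

theorem torusIntegral_zero_one {a : ℝ} (ha : 0 < a) (ha' : a < 1) (u v : ℤ) :
    torusIntegral a 0 0 0 1 u v = latticeEntry a u v := by
  rw [latticeEntry, ← one_mul (_ + _ : ℂ)]
  refine torusIntegral_eq_latticeGreen ha ha' fun z w hz hw => ?_
  rw [inv_magneticKasteleyn hz hw, zpow_add_one₀ hz]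
  simp only [Matrix.smul_apply, Matrix.of_apply, Matrix.cons_val, smul_eq_mul]
  ring

theorem torusIntegral_one_zero {a : ℝ} (ha : 0 < a) (ha' : a < 1) (u v : ℤ) :
    torusIntegral a 0 0 1 0 u v = latticeEntry a (-u) v := by
  rw [latticeEntry, latticeGreen_neg_left ha ha', show -u + 1 = -(u - 1) by ring,
    latticeGreen_neg_left ha ha', ← one_mul (_ + _ : ℂ)]
  refine torusIntegral_eq_latticeGreen ha ha' fun z w hz hw => ?_
  rw [inv_magneticKasteleyn hz hw, zpow_sub_one₀ hz]
  simp only [Matrix.smul_apply, Matrix.of_apply, Matrix.cons_val, smul_eq_mul]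
  ring

theorem torusIntegral_zero_zero {a : ℝ} (ha : 0 < a) (ha' : a < 1) (u v : ℤ) :
    torusIntegral a 0 0 0 0 u v = 1 / Complex.I * latticeEntry a v u := by
  rw [latticeEntry, latticeGreen_swap ha ha' v u, latticeGreen_swap ha ha' (v + 1) u]
  refine torusIntegral_eq_latticeGreen ha ha' fun z w hz hw => ?_
  rw [inv_magneticKasteleyn hz hw, zpow_add_one₀ hw, one_div, Complex.inv_I]
  simp only [Matrix.smul_apply, Matrix.of_apply, Matrix.cons_val, smul_eq_mul]
  ring

theorem torusIntegral_one_one {a : ℝ} (ha : 0 < a) (ha' : a < 1) (u v : ℤ) :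
    torusIntegral a 0 0 1 1 u v = 1 / Complex.I * latticeEntry a (-v) u := by
  rw [latticeEntry, latticeGreen_neg_left ha ha', show -v + 1 = -(v - 1) by ring,
    latticeGreen_neg_left ha ha', latticeGreen_swap ha ha' v u,
    latticeGreen_swap ha ha' (v - 1) u]
  refine torusIntegral_eq_latticeGreen ha ha' fun z w hz hw => ?_
  rw [inv_magneticKasteleyn hz hw, zpow_sub_one₀ hw, one_div, Complex.inv_I]
  simp only [Matrix.smul_apply, Matrix.of_apply, Matrix.cons_val, smul_eq_mul]
  ring

/-- The weight for which `diffWeight n (decayRoot s)` is the difference of two consecutive values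
of the Green kernel; unlike these values it has no singularity at `s = 0`. -/
def diffWeight (n : ℕ) (r : ℝ) : ℝ := r ^ n * (r / (1 + r))

/-- The weight for which `meanWeight n (decayRoot s)` is the defect, from the value at `0`, of the
mean of two consecutive values of the Green kernel; it has no singularity at `s = 0`. -/
def meanWeight (n : ℕ) (r : ℝ) : ℝ :=
  (1 / 2 * r ^ n + ∑ i ∈ Finset.range n, r ^ i) * (r / (1 + r))

/-- The cosine transform of `f (decayRoot s)` along the dispersion relation of squared mass `δ`. -/
def cosTransform (f : ℝ → ℝ) (v : ℤ) (δ : ℝ) : ℝ :=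
  ∫ β in 0..π, cos (v * β) * f (decayRoot (dispersion δ β))

theorem greenKernel_eq_div (n : ℕ) (s : ℝ) :
    greenKernel n s = decayRoot s ^ n / ((decayRoot s)⁻¹ - decayRoot s) := by
  rw [greenKernel, inv_decayRoot_sub]

theorem inv_decayRoot_sub_ne_zero {s : ℝ} (hs : 0 < s) : (decayRoot s)⁻¹ - decayRoot s ≠ 0 := by
  rw [inv_decayRoot_sub]; positivity

theorem greenKernel_sub {s : ℝ} (hs : 0 < s) (n : ℕ) :
    greenKernel n s - greenKernel (n + 1) s = diffWeight n (decayRoot s) := by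
  have hgap := inv_decayRoot_sub_ne_zero hs
  have hpos := decayRoot_pos s
  rw [greenKernel_eq_div, greenKernel_eq_div, ← sub_div, div_eq_iff hgap, diffWeight]
  field_simp
  ring

theorem greenKernel_add {s : ℝ} (hs : 0 < s) (n : ℕ) :
    (greenKernel n s + greenKernel (n + 1) s) / 2 =
      greenKernel 0 s - meanWeight n (decayRoot s) := by
  have hgap := inv_decayRoot_sub_ne_zero hs
  have hpos := decayRoot_pos s
  have hgeom := geom_sum_mul_neg (decayRoot s) n
  have hmean : meanWeight n (decayRoot s) =
      (1 - (decayRoot s ^ n + decayRoot s ^ (n + 1)) / 2) /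
        ((decayRoot s)⁻¹ - decayRoot s) := by
    rw [eq_div_iff hgap, meanWeight]
    field_simp
    linear_combination 2 * (1 + decayRoot s) * hgeom
  rw [hmean, greenKernel_eq_div, greenKernel_eq_div, greenKernel_eq_div]
  ring

theorem dispersion_nonneg (δ β : ℝ) : 0 ≤ dispersion δ β := sqrt_nonneg _

theorem dispersion_sq {δ : ℝ} (hδ : 0 ≤ δ) (β : ℝ) :
    dispersion δ β ^ 2 = sin (β / 2) ^ 2 + δ := sq_sqrt (by positivity)

theorem dispersion_pos {δ : ℝ} (hδ : 0 < δ) (β : ℝ) : 0 < dispersion δ β :=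
  sqrt_pos.2 (by positivity)

theorem continuous_dispersion (δ : ℝ) : Continuous (dispersion δ) := by
  unfold dispersion; fun_prop

theorem sin_half_nonneg {β : ℝ} (hβ : β ∈ Icc 0 π) : 0 ≤ sin (β / 2) :=
  sin_nonneg_of_nonneg_of_le_pi (by linarith [hβ.1]) (by linarith [hβ.1, hβ.2])

theorem sin_half_pos {β : ℝ} (hβ : β ∈ Ioc 0 π) : 0 < sin (β / 2) :=
  sin_pos_of_pos_of_lt_pi (by linarith [hβ.1]) (by linarith [hβ.1, hβ.2, pi_pos])

theorem cos_half_nonneg {β : ℝ} (hβ : β ∈ Icc 0 π) : 0 ≤ cos (β / 2) :=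
  cos_nonneg_of_mem_Icc ⟨by linarith [hβ.1, pi_pos], by linarith [hβ.2]⟩

theorem dispersion_zero {β : ℝ} (hβ : β ∈ Icc 0 π) : dispersion 0 β = sin (β / 2) := by
  rw [dispersion, add_zero, sqrt_sq (sin_half_nonneg hβ)]

theorem sin_half_le_dispersion {δ : ℝ} (hδ : 0 ≤ δ) (β : ℝ) : sin (β / 2) ≤ dispersion δ β :=
  le_sqrt_of_sq_le (by linarith)

theorem abs_dispersion_sub_le {δ β : ℝ} (hδ : 0 < δ) (hβ : β ∈ Icc 0 π) :
    |dispersion δ β - dispersion 0 β| ≤ δ / dispersion δ β := by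
  have hle := sin_half_le_dispersion hδ.le β
  rw [dispersion_zero hβ, abs_of_nonneg (by linarith), le_div_iff₀ (dispersion_pos hδ β)]
  nlinarith [sin_half_nonneg hβ, dispersion_sq hδ.le β]

theorem continuous_greenKernel_dispersion (n : ℕ) {δ : ℝ} (hδ : 0 < δ) :
    Continuous fun β => greenKernel n (dispersion δ β) := by
  have hpos := dispersion_pos hδ
  have hcont := continuous_dispersion δ
  refine Continuous.div ((continuous_decayRoot.comp hcont).pow n) (by fun_prop) fun β => ?_
  have := hpos β
  positivity

theorem intervalIntegrable_cos_mul_greenKernel {δ : ℝ} (hδ : 0 < δ) (n : ℕ) (v : ℤ) :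
    IntervalIntegrable (fun β => cos (v * β) * greenKernel n (dispersion δ β))
      MeasureTheory.volume 0 π :=
  (Continuous.mul (by fun_prop) (continuous_greenKernel_dispersion n hδ)).intervalIntegrable _ _

theorem decayRoot_dispersion_mem_Icc (δ β : ℝ) : decayRoot (dispersion δ β) ∈ Icc (0 : ℝ) 1 :=
  ⟨(decayRoot_pos _).le, decayRoot_le_one (dispersion_nonneg δ β)⟩

theorem continuous_comp_decayRoot_dispersion {f : ℝ → ℝ} (hf : ContinuousOn f (Icc 0 1)) (δ : ℝ) :
    Continuous fun β => f (decayRoot (dispersion δ β)) :=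
  hf.comp_continuous (continuous_decayRoot.comp (continuous_dispersion δ))
    (decayRoot_dispersion_mem_Icc δ)

theorem contDiffOn_diffWeight (n : ℕ) : ContDiffOn ℝ 1 (diffWeight n) (Icc 0 1) :=
  ContDiffOn.mul (by fun_prop)
    (ContDiffOn.div (by fun_prop) (by fun_prop) fun r hr => by linarith [hr.1])

theorem contDiffOn_meanWeight (n : ℕ) : ContDiffOn ℝ 1 (meanWeight n) (Icc 0 1) :=
  ContDiffOn.mul (by fun_prop)
    (ContDiffOn.div (by fun_prop) (by fun_prop) fun r hr => by linarith [hr.1])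

theorem massiveGreen_sub {δ : ℝ} (hδ : 0 < δ) (n : ℕ) (v : ℤ) :
    massiveGreen δ n v - massiveGreen δ (n + 1) v = cosTransform (diffWeight n) v δ := by
  have hint (k : ℕ) := intervalIntegrable_cos_mul_greenKernel hδ k v
  rw [massiveGreen, massiveGreen, ← intervalIntegral.integral_sub (hint n) (hint (n + 1))]
  simp only [cosTransform, ← mul_sub, greenKernel_sub (dispersion_pos hδ _)]

theorem massiveGreen_add {δ : ℝ} (hδ : 0 < δ) (n : ℕ) (v : ℤ) :
    (massiveGreen δ n v + massiveGreen δ (n + 1) v) / 2 =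
      massiveGreen δ 0 v - cosTransform (meanWeight n) v δ := by
  have hint (k : ℕ) := intervalIntegrable_cos_mul_greenKernel hδ k v
  have hintMean : IntervalIntegrable (fun β => cos (v * β) *
      meanWeight n (decayRoot (dispersion δ β))) MeasureTheory.volume 0 π :=
    (Continuous.mul (by fun_prop) (continuous_comp_decayRoot_dispersion
      (contDiffOn_meanWeight n).continuousOn δ)).intervalIntegrable _ _
  rw [massiveGreen, massiveGreen, massiveGreen, cosTransform,
    ← intervalIntegral.integral_add (hint n) (hint (n + 1)), ← intervalIntegral.integral_div,
    ← intervalIntegral.integral_sub (hint 0) hintMean]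
  simp only [← mul_sub, ← greenKernel_add (dispersion_pos hδ _), ← mul_add, mul_div_assoc]

theorem continuous_cos_half_div_dispersion {δ : ℝ} (hδ : 0 < δ) :
    Continuous fun β => cos (β / 2) / dispersion δ β :=
  Continuous.div (by fun_prop) (continuous_dispersion δ) fun β => (dispersion_pos hδ β).ne'

theorem integral_cos_half_div_dispersion {δ : ℝ} (hδ : 0 < δ) :
    ∫ β in 0..π, cos (β / 2) / dispersion δ β = 2 * arsinh (1 / √δ) := by
  have hderiv (β : ℝ) : HasDerivAt (fun β => 2 * arsinh (sin (β / 2) / √δ))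
      (cos (β / 2) / dispersion δ β) β := by
    have hroot : dispersion δ β = √δ * √(1 + (sin (β / 2) / √δ) ^ 2) := by
      rw [← sqrt_mul hδ.le, div_pow, sq_sqrt hδ.le, dispersion]
      congr 1
      field_simp
      ring
    refine ((((((hasDerivAt_id' β).div_const 2).sin).div_const √δ).arsinh).const_mul
      2).congr_deriv ?_
    rw [hroot, smul_eq_mul]
    field_simp
  rw [intervalIntegral.integral_eq_sub_of_hasDerivAt (fun β _ => hderiv β)
    ((continuous_cos_half_div_dispersion hδ).intervalIntegrable _ _)]
  simp

/-- `1 - cos (β / 2)` is dominated by the dispersion, so only the explicit integral of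
`cos (β / 2) / dispersion δ β` diverges as `δ → 0`. -/
theorem integral_inv_dispersion_le {δ : ℝ} (hδ : 0 < δ) :
    ∫ β in 0..π, (dispersion δ β)⁻¹ ≤ 2 * arsinh (1 / √δ) + π := by
  have hint := (continuous_cos_half_div_dispersion hδ).intervalIntegrable
    (μ := MeasureTheory.volume) 0 π
  have hbound : ∀ β ∈ Icc 0 π, (dispersion δ β)⁻¹ ≤ cos (β / 2) / dispersion δ β + 1 := by
    intro β hβ
    have hdisp := dispersion_pos hδ β
    rw [div_add_one hdisp.ne', inv_eq_one_div]
    gcongr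
    nlinarith [sin_half_le_dispersion hδ.le β, sin_sq_add_cos_sq (β / 2), sin_half_nonneg hβ,
      cos_half_nonneg hβ]
  have hmono := intervalIntegral.integral_mono_on pi_pos.le
    (((continuous_dispersion δ).inv₀ fun β => (dispersion_pos hδ β).ne').intervalIntegrable _ _)
    (hint.add intervalIntegrable_const) hbound
  rwa [intervalIntegral.integral_add hint intervalIntegrable_const,
    integral_cos_half_div_dispersion hδ, intervalIntegral.integral_const, sub_zero, smul_eq_mul,
    mul_one] at hmono

theorem abs_cosTransform_sub_le {f : ℝ → ℝ} {K : NNReal} (hf : LipschitzOnWith K f (Icc 0 1))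
    (v : ℤ) {δ : ℝ} (hδ : 0 < δ) :
    |cosTransform f v δ - cosTransform f v 0| ≤ 2 * K * δ * (2 * arsinh (1 / √δ) + π) := by
  have hint (ε : ℝ) : IntervalIntegrable
      (fun β => cos (v * β) * f (decayRoot (dispersion ε β))) MeasureTheory.volume 0 π :=
    (Continuous.mul (by fun_prop)
      (continuous_comp_decayRoot_dispersion hf.continuousOn ε)).intervalIntegrable _ _
  have hpoint : ∀ β ∈ Ioc 0 π, ‖cos (v * β) * f (decayRoot (dispersion δ β)) -
      cos (v * β) * f (decayRoot (dispersion 0 β))‖ ≤ 2 * K * δ * (dispersion δ β)⁻¹ := by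
    intro β hβ
    rw [← mul_sub, norm_mul]
    calc _ ≤ 1 * ‖f (decayRoot (dispersion δ β)) - f (decayRoot (dispersion 0 β))‖ := by
          gcongr; exact abs_cos_le_one _
      _ ≤ K * |decayRoot (dispersion δ β) - decayRoot (dispersion 0 β)| := by
          rw [one_mul]
          exact hf.norm_sub_le (decayRoot_dispersion_mem_Icc δ β) (decayRoot_dispersion_mem_Icc 0 β)
      _ ≤ K * (2 * |dispersion δ β - dispersion 0 β|) := by
          gcongr
          exact abs_decayRoot_sub_le (dispersion_nonneg 0 β) (dispersion_nonneg δ β)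
      _ ≤ K * (2 * (δ / dispersion δ β)) := by
          gcongr
          exact abs_dispersion_sub_le hδ (Ioc_subset_Icc_self hβ)
      _ = _ := by ring
  rw [cosTransform, cosTransform, ← intervalIntegral.integral_sub (hint δ) (hint 0)]
  refine (intervalIntegral.norm_integral_le_of_norm_le pi_pos.le
    (Eventually.of_forall hpoint) ?_).trans ?_
  · exact (continuous_const.mul ((continuous_dispersion δ).inv₀
      fun β => (dispersion_pos hδ β).ne')).intervalIntegrable _ _
  · rw [intervalIntegral.integral_const_mul]
    gcongr
    exact integral_inv_dispersion_le hδ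

/-- The finite part, as `δ → 0`, of the transformed Green function `massiveGreen δ 0 v`, once the
integral of `cos (β / 2) / (4 * dispersion δ β)` has been subtracted. -/
def regularPart (v : ℤ) : ℝ :=
  ∫ β in 0..π, (4 * sin (β / 2))⁻¹ * (cos (v * β) / √(1 + sin (β / 2) ^ 2) - cos (β / 2))

theorem abs_one_sub_cos_mul_le (v : ℝ) {β : ℝ} (hβ : β ∈ Icc 0 π) :
    |1 - cos (v * β)| ≤ v ^ 2 * π ^ 2 * sin (β / 2) ^ 2 := by
  have hjordan : β ≤ π * sin (β / 2) := by
    have := mul_le_sin (x := β / 2) (by linarith [hβ.1]) (by linarith [hβ.2])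
    rwa [show 2 / π * (β / 2) = β / π by ring, div_le_iff₀' pi_pos] at this
  calc |1 - cos (v * β)| = 1 - cos (v * β) := abs_of_nonneg (by linarith [cos_le_one (v * β)])
    _ ≤ (v * β) ^ 2 / 2 := by linarith [one_sub_sq_div_two_le_cos (x := v * β)]
    _ ≤ (v * β) ^ 2 := half_le_self (sq_nonneg _)
    _ = v ^ 2 * β ^ 2 := mul_pow _ _ _
    _ ≤ v ^ 2 * (π * sin (β / 2)) ^ 2 := by gcongr; exact hβ.1
    _ = v ^ 2 * π ^ 2 * sin (β / 2) ^ 2 := by ring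

theorem abs_inv_sqrt_add_sub_le {x δ : ℝ} (hx : 1 ≤ x) (hδ : 0 ≤ δ) :
    |(√(x + δ))⁻¹ - (√x)⁻¹| ≤ δ := by
  have hroot : 1 ≤ √x := one_le_sqrt.2 hx
  have hmono : √x ≤ √(x + δ) := sqrt_le_sqrt (by linarith)
  have hsq : √(x + δ) ^ 2 = √x ^ 2 + δ := by rw [sq_sqrt (by linarith), sq_sqrt (by linarith)]
  rw [abs_sub_comm, abs_of_nonneg (sub_nonneg.2 (inv_anti₀ (by linarith) hmono)),
    inv_sub_inv (by positivity) (by positivity), div_le_iff₀ (by positivity)]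
  have hgap : √(x + δ) - √x ≤ δ := by nlinarith
  exact hgap.trans (le_mul_of_one_le_right hδ (one_le_mul_of_one_le_of_one_le hroot
    (hroot.trans hmono)))

theorem exists_abs_cos_div_sqrt_sub_cos_half_le (v : ℤ) : ∃ C : ℝ, 0 ≤ C ∧ ∀ β ∈ Icc 0 π,
    |cos (v * β) / √(1 + sin (β / 2) ^ 2) - cos (β / 2)| ≤ C * sin (β / 2) ^ 2 := by
  refine ⟨v ^ 2 * π ^ 2 + 1 + (1 / 2) ^ 2 * π ^ 2, by positivity, fun β hβ => ?_⟩
  have hcos := abs_one_sub_cos_mul_le v hβ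
  have hcosHalf := abs_one_sub_cos_mul_le (1 / 2) hβ
  rw [one_div_mul_eq_div] at hcosHalf
  have hinv := abs_inv_sqrt_add_sub_le le_rfl (sq_nonneg (sin (β / 2)))
  rw [sqrt_one, inv_one] at hinv
  calc |cos (v * β) / √(1 + sin (β / 2) ^ 2) - cos (β / 2)|
      = |-(1 - cos (v * β)) + cos (v * β) * ((√(1 + sin (β / 2) ^ 2))⁻¹ - 1) +
          (1 - cos (β / 2))| := by congr 1; ring
    _ ≤ |1 - cos (v * β)| + |cos (v * β)| * |(√(1 + sin (β / 2) ^ 2))⁻¹ - 1| +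
          |1 - cos (β / 2)| := by
        refine (abs_add_three _ _ _).trans_eq ?_
        rw [abs_neg, abs_mul]
    _ ≤ v ^ 2 * π ^ 2 * sin (β / 2) ^ 2 + 1 * sin (β / 2) ^ 2 +
          (1 / 2) ^ 2 * π ^ 2 * sin (β / 2) ^ 2 := by
        gcongr
        exact abs_cos_le_one _
    _ = _ := by ring

theorem intervalIntegrable_regularPart (v : ℤ) : IntervalIntegrable
    (fun β => (4 * sin (β / 2))⁻¹ * (cos (v * β) / √(1 + sin (β / 2) ^ 2) - cos (β / 2)))
    MeasureTheory.volume 0 π := by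
  obtain ⟨C, hC, hbound⟩ := exists_abs_cos_div_sqrt_sub_cos_half_le v
  rw [intervalIntegrable_iff_integrableOn_Ioc_of_le pi_pos.le]
  refine MeasureTheory.Measure.integrableOn_of_bounded (M := C) (by simp)
    (Measurable.aestronglyMeasurable (by fun_prop))
    ((MeasureTheory.ae_restrict_iff' measurableSet_Ioc).2 (Eventually.of_forall fun β hβ => ?_))
  have hsin := sin_half_pos hβ
  rw [norm_mul, norm_of_nonneg (by positivity), inv_mul_le_iff₀ (by positivity)]
  refine (hbound β (Ioc_subset_Icc_self hβ)).trans ?_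
  nlinarith [mul_nonneg hC hsin.le, sin_le_one (β / 2)]

theorem sqrt_le_dispersion (δ β : ℝ) : √δ ≤ dispersion δ β :=
  sqrt_le_sqrt (by linarith [sq_nonneg (sin (β / 2))])

theorem dispersion_sub_sin_half_le {δ β : ℝ} (hδ : 0 ≤ δ) (hβ : β ∈ Icc 0 π) :
    dispersion δ β - sin (β / 2) ≤ √δ := by
  have hsin := sin_half_nonneg hβ
  rw [sub_le_iff_le_add', dispersion, sqrt_le_iff]
  refine ⟨by positivity, ?_⟩
  nlinarith [sq_sqrt hδ, mul_nonneg hsin (sqrt_nonneg δ)]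

theorem sin_half_sq_mul_inv_sub_inv_le {δ β : ℝ} (hδ : 0 < δ) (hβ : β ∈ Ioc 0 π) :
    sin (β / 2) ^ 2 * ((sin (β / 2))⁻¹ - (dispersion δ β)⁻¹) ≤ √δ := by
  have hsin := sin_half_pos hβ
  have hdisp := dispersion_pos hδ β
  have hle := sin_half_le_dispersion hδ.le β
  calc sin (β / 2) ^ 2 * ((sin (β / 2))⁻¹ - (dispersion δ β)⁻¹)
      = sin (β / 2) / dispersion δ β * (dispersion δ β - sin (β / 2)) := by field_simp
    _ ≤ 1 * √δ := mul_le_mul (div_le_one_of_le₀ hle hdisp.le)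
        (dispersion_sub_sin_half_le hδ.le (Ioc_subset_Icc_self hβ)) (sub_nonneg.2 hle) zero_le_one
    _ = √δ := one_mul _

theorem abs_inv_sqrt_one_add_dispersion_sq_sub_mul_inv_le {δ : ℝ} (hδ : 0 < δ) (β : ℝ) :
    |(√(1 + dispersion δ β ^ 2))⁻¹ - (√(1 + sin (β / 2) ^ 2))⁻¹| * (dispersion δ β)⁻¹ ≤ √δ := by
  have hinv := abs_inv_sqrt_add_sub_le (x := 1 + sin (β / 2) ^ 2)
    (by linarith [sq_nonneg (sin (β / 2))]) hδ.le
  rw [add_assoc, ← dispersion_sq hδ.le] at hinv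
  have hdisp := dispersion_pos hδ β
  rw [← div_eq_mul_inv, div_le_iff₀ hdisp]
  calc _ ≤ δ := hinv
    _ = √δ * √δ := (mul_self_sqrt hδ.le).symm
    _ ≤ √δ * dispersion δ β := by gcongr; exact sqrt_le_dispersion δ β

theorem abs_cos_mul_greenKernel_zero_sub_le {C : ℝ} (hC : 0 ≤ C) {v : ℤ} {δ β : ℝ} (hδ : 0 < δ)
    (hβ : β ∈ Ioc 0 π)
    (hbound : |cos (v * β) / √(1 + sin (β / 2) ^ 2) - cos (β / 2)| ≤ C * sin (β / 2) ^ 2) :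
    |cos (v * β) * greenKernel 0 (dispersion δ β) - (1 / 4 * (cos (β / 2) / dispersion δ β) +
      (4 * sin (β / 2))⁻¹ * (cos (v * β) / √(1 + sin (β / 2) ^ 2) - cos (β / 2)))| ≤
      (1 + C) / 4 * √δ := by
  have hroots := abs_inv_sqrt_one_add_dispersion_sq_sub_mul_inv_le hδ β
  have hinvs := mul_le_mul_of_nonneg_left (sin_half_sq_mul_inv_sub_inv_le hδ hβ) hC
  have hanti := sub_nonneg.2 (inv_anti₀ (sin_half_pos hβ) (sin_half_le_dispersion hδ.le β))
  have hdisp := dispersion_pos hδ β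
  rw [greenKernel, pow_zero]
  set σ := sin (β / 2)
  set s := dispersion δ β
  set T := √(1 + σ ^ 2)
  calc _ = |1 / 4 * (cos (v * β) * ((√(1 + s ^ 2))⁻¹ - T⁻¹) * s⁻¹ -
        (cos (v * β) / T - cos (β / 2)) * (σ⁻¹ - s⁻¹))| := by
        congr 1
        simp only [div_eq_mul_inv, mul_inv]
        ring
    _ ≤ 1 / 4 * (1 * |(√(1 + s ^ 2))⁻¹ - T⁻¹| * s⁻¹ + C * σ ^ 2 * (σ⁻¹ - s⁻¹)) := by
        rw [abs_mul, abs_of_pos (by norm_num : (0 : ℝ) < 1 / 4)]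
        refine mul_le_mul_of_nonneg_left ((abs_sub _ _).trans ?_) (by norm_num)
        rw [abs_mul, abs_mul, abs_mul, abs_of_pos (inv_pos.2 hdisp), abs_of_nonneg hanti]
        gcongr
        exact abs_cos_le_one _
    _ ≤ (1 + C) / 4 * √δ := by linarith

theorem exists_abs_massiveGreen_zero_sub_le (v : ℤ) : ∃ C : ℝ, ∀ δ : ℝ, 0 < δ →
    |massiveGreen δ 0 v - (1 / 2 * arsinh (1 / √δ) + regularPart v)| ≤ C * √δ := by
  obtain ⟨C, hC, hbound⟩ := exists_abs_cos_div_sqrt_sub_cos_half_le v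
  refine ⟨(1 + C) / 4 * π, fun δ hδ => ?_⟩
  have hintGreen := intervalIntegrable_cos_mul_greenKernel hδ 0 v
  have hintSing := ((continuous_cos_half_div_dispersion hδ).intervalIntegrable
    (μ := MeasureTheory.volume) 0 π).const_mul (1 / 4)
  have hsing : 1 / 2 * arsinh (1 / √δ) = ∫ β in 0..π, 1 / 4 * (cos (β / 2) / dispersion δ β) := by
    rw [intervalIntegral.integral_const_mul, integral_cos_half_div_dispersion hδ]
    ring
  rw [massiveGreen, regularPart, hsing,
    ← intervalIntegral.integral_add hintSing (intervalIntegrable_regularPart v),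
    ← intervalIntegral.integral_sub hintGreen (hintSing.add (intervalIntegrable_regularPart v)),
    ← norm_eq_abs]
  refine (intervalIntegral.norm_integral_le_of_norm_le_const (C := (1 + C) / 4 * √δ)
    fun β hβ => ?_).trans_eq ?_
  · rw [uIoc_of_le pi_pos.le] at hβ
    exact abs_cos_mul_greenKernel_zero_sub_le hC hδ hβ (hbound β (Ioc_subset_Icc_self hβ))
  · rw [sub_zero, abs_of_pos pi_pos]
    ring

theorem isBigO_one_log : (fun _ => (1 : ℝ)) =O[𝓝[>] 0] log :=
  ((isLittleO_const_left.2 (Or.inr (tendsto_abs_atBot_atTop.comp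
    tendsto_log_nhdsGT_zero))).isBigO : (fun _ => (1 : ℝ)) =O[𝓝[>] 0] log)

theorem isBigO_mul_log_one : (fun h : ℝ => h * log h) =O[𝓝[>] 0] fun _ => (1 : ℝ) :=
  ((continuous_mul_log.tendsto 0).mono_left nhdsWithin_le_nhds).isBigO_one ℝ

theorem isBigO_sq_sq_mul_log : (fun h : ℝ => h ^ 2) =O[𝓝[>] 0] fun h => h ^ 2 * log h := by
  simpa using (isBigO_refl (fun h : ℝ => h ^ 2) (𝓝[>] 0)).mul isBigO_one_log

theorem isBigO_sq_mul_log_id : (fun h : ℝ => h ^ 2 * log h) =O[𝓝[>] 0] fun h => h := by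
  simpa [pow_two, mul_assoc] using (isBigO_refl (fun h : ℝ => h) (𝓝[>] 0)).mul isBigO_mul_log_one

theorem mass_one_sub (h : ℝ) : mass (1 - h) = h ^ 2 / (2 * (1 - h)) := by
  rw [mass, sub_sub_cancel]

theorem eventually_mass_one_sub_mem_Ioc : ∀ᶠ h : ℝ in 𝓝[>] 0, mass (1 - h) ∈ Ioc 0 (h ^ 2) := by
  filter_upwards [Ioo_mem_nhdsGT (by norm_num : (0 : ℝ) < 1 / 2)] with h hh
  have ha : 0 < 1 - h := by linarith [hh.2]
  refine ⟨mass_pos ha (by linarith [hh.1]), ?_⟩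
  rw [mass_one_sub]
  exact div_le_self (sq_nonneg h) (by linarith [hh.2])

theorem isBigO_mass_one_sub : (fun h => mass (1 - h)) =O[𝓝[>] 0] fun h => h ^ 2 :=
  IsBigO.of_bound' <| eventually_mass_one_sub_mem_Ioc.mono fun h hh => by
    rw [norm_of_nonneg hh.1.le, norm_of_nonneg (sq_nonneg h)]
    exact hh.2

theorem isBigO_sqrt_mass_one_sub : (fun h => √(mass (1 - h))) =O[𝓝[>] 0] fun h => h :=
  IsBigO.of_bound' <| eventually_mass_one_sub_mem_Ioc.mono fun h hh => by
    rw [norm_of_nonneg (sqrt_nonneg _), norm_eq_abs, ← sqrt_sq_eq_abs]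
    exact sqrt_le_sqrt hh.2

theorem arsinh_one_div_sqrt {δ : ℝ} (hδ : 0 < δ) :
    arsinh (1 / √δ) = log (1 + √(1 + δ)) - 1 / 2 * log δ := by
  have hroot := sqrt_pos.2 hδ
  rw [arsinh, div_pow, sq_sqrt hδ.le, one_pow, one_add_div hδ.ne', add_comm δ,
    sqrt_div (by linarith), ← add_div, log_div (by positivity) hroot.ne', log_sqrt hδ.le]
  ring

theorem isBigO_arsinh_mass_sub_log :
    (fun h => arsinh (1 / √(mass (1 - h))) - (3 / 2 * log 2 - log h)) =O[𝓝[>] 0] fun h => h := by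
  set F : ℝ → ℝ := fun h => log (1 + √(1 + h ^ 2 / (2 * (1 - h)))) + 1 / 2 * log (1 - h) with hF
  have hF0 : F 0 = log 2 := by norm_num [hF]
  have hdiff : DifferentiableAt ℝ F 0 := by
    have hquot : DifferentiableAt ℝ (fun h : ℝ => 1 + h ^ 2 / (2 * (1 - h))) 0 := by
      fun_prop (disch := norm_num)
    refine DifferentiableAt.add (DifferentiableAt.log ((hquot.sqrt ?_).const_add 1) ?_) ?_
    · norm_num
    · norm_num
    · fun_prop (disch := norm_num)
  refine ((hdiff.isBigO_sub.mono nhdsWithin_le_nhds).congr' ?_ ?_ :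
    _ =O[𝓝[>] 0] fun h : ℝ => h)
  · filter_upwards [Ioo_mem_nhdsGT (zero_lt_one' ℝ)] with h hh
    have ha : 0 < 1 - h := by linarith [hh.2]
    have hpos := hh.1
    have hlog : log (mass (1 - h)) = 2 * log h - log 2 - log (1 - h) := by
      rw [mass_one_sub, log_div (by positivity) (by positivity), log_mul two_ne_zero ha.ne',
        log_pow]
      push_cast
      ring
    rw [arsinh_one_div_sqrt (mass_pos ha (by linarith)), hlog, mass_one_sub, hF0, hF]
    ring
  · simp

theorem isBigO_arsinh_mass_log :
    (fun h => 2 * arsinh (1 / √(mass (1 - h))) + π) =O[𝓝[>] 0] log := by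
  have hid : (fun h : ℝ => h) =O[𝓝[>] 0] log :=
    (((continuous_id.tendsto 0).mono_left nhdsWithin_le_nhds).isBigO_one ℝ).trans isBigO_one_log
  have hconst (c : ℝ) : (fun _ => c) =O[𝓝[>] 0] log :=
    (isBigO_const_const c one_ne_zero _).trans isBigO_one_log
  refine ((((isBigO_arsinh_mass_sub_log.trans hid).sub (isBigO_refl log _)).const_mul_left 2).add
    (hconst (3 * log 2 + π))).congr_left fun h => ?_
  ring

theorem isBigO_cosTransform_mass_sub {f : ℝ → ℝ} (hf : ContDiffOn ℝ 1 f (Icc 0 1)) (v : ℤ) :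
    (fun h => cosTransform f v (mass (1 - h)) - cosTransform f v 0) =O[𝓝[>] 0]
      fun h => h ^ 2 * log h := by
  obtain ⟨K, hK⟩ := (hf.locallyLipschitzOn (convex_Icc 0 1)).exists_lipschitzOnWith_of_compact
    isCompact_Icc
  refine IsBigO.trans (IsBigO.of_bound (2 * K : ℝ) ?_)
    (isBigO_mass_one_sub.mul isBigO_arsinh_mass_log)
  filter_upwards [eventually_mass_one_sub_mem_Ioc] with h hh
  refine (abs_cosTransform_sub_le hK v hh.1).trans ?_
  rw [mul_assoc (2 * K : ℝ)]
  gcongr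
  exact le_norm_self _

theorem isBigO_massiveGreen_zero_sub (v : ℤ) :
    (fun h => massiveGreen (mass (1 - h)) 0 v - (3 / 4 * log 2 - 1 / 2 * log h + regularPart v))
      =O[𝓝[>] 0] fun h => h := by
  obtain ⟨C, hC⟩ := exists_abs_massiveGreen_zero_sub_le v
  have hmassless : (fun h => massiveGreen (mass (1 - h)) 0 v -
      (1 / 2 * arsinh (1 / √(mass (1 - h))) + regularPart v)) =O[𝓝[>] 0] fun h => h := by
    refine IsBigO.trans (IsBigO.of_bound C ?_) isBigO_sqrt_mass_one_sub
    filter_upwards [eventually_mass_one_sub_mem_Ioc] with h hh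
    rw [norm_of_nonneg (sqrt_nonneg _)]
    exact hC _ hh.1
  refine (hmassless.add (isBigO_arsinh_mass_sub_log.const_mul_left (1 / 2))).congr_left fun h => ?_
  ring

/-- The constant term of the mean of two consecutive massive Green functions, with its sign
changed; it is `π` times the coefficient `c₂`. -/
def meanCoeff (n : ℕ) (v : ℤ) : ℝ :=
  cosTransform (meanWeight n) v 0 - (regularPart v + 3 / 4 * log 2)

theorem isBigO_massiveGreen_sub (n : ℕ) (v : ℤ) :
    (fun h => massiveGreen (mass (1 - h)) n v - massiveGreen (mass (1 - h)) (n + 1) v -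
      cosTransform (diffWeight n) v 0) =O[𝓝[>] 0] fun h => h ^ 2 * log h :=
  (isBigO_cosTransform_mass_sub (contDiffOn_diffWeight n) v).congr'
    (eventually_mass_one_sub_mem_Ioc.mono fun _ hh => by simp only [massiveGreen_sub hh.1]) .rfl

theorem isBigO_massiveGreen_add (n : ℕ) (v : ℤ) :
    (fun h => (massiveGreen (mass (1 - h)) n v + massiveGreen (mass (1 - h)) (n + 1) v) / 2 +
      (1 / 2 * log h + meanCoeff n v)) =O[𝓝[>] 0] fun h => h := by
  refine ((isBigO_massiveGreen_zero_sub v).sub ((isBigO_cosTransform_mass_sub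
    (contDiffOn_meanWeight n) v).trans isBigO_sq_mul_log_id)).congr'
    (eventually_mass_one_sub_mem_Ioc.mono fun _ hh => ?_) .rfl
  simp only [massiveGreen_add hh.1, meanCoeff]
  ring

/-- The combinations of consecutive Green functions entering `𝕂⁻¹` are, up to the factor
`(1 - h)⁻¹`, of the form `s * (1 - h / 2) * difference - h * mean` with `s = ± 1`. -/
theorem isBigO_massiveGreen_combination (s : ℝ) (n : ℕ) (v : ℤ) :
    (fun h => (1 - h)⁻¹ * (s * (1 - h / 2) *
        (massiveGreen (mass (1 - h)) n v - massiveGreen (mass (1 - h)) (n + 1) v) -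
        h * ((massiveGreen (mass (1 - h)) n v + massiveGreen (mass (1 - h)) (n + 1) v) / 2)) -
      (s * (1 + h / 2) * cosTransform (diffWeight n) v 0 + h * (1 / 2 * log h + meanCoeff n v)))
      =O[𝓝[>] 0] fun h => h ^ 2 * log h := by
  have hbounded {f : ℝ → ℝ} (hf : ContinuousAt f 0) : f =O[𝓝[>] 0] fun _ => (1 : ℝ) :=
    (hf.mono_left nhdsWithin_le_nhds).isBigO_one ℝ
  have hdiff := (hbounded (f := fun h => s * (1 - h / 2)) (by fun_prop)).mul
    (isBigO_massiveGreen_sub n v)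
  have hmean := ((isBigO_refl (fun h : ℝ => h) (𝓝[>] 0)).mul
    (isBigO_massiveGreen_add n v)).congr_right fun h => (pow_two h).symm
  have hlog : (fun h => h ^ 2 * (1 / 2 * log h + meanCoeff n v + s *
      cosTransform (diffWeight n) v 0 / 2)) =O[𝓝[>] 0] fun h => h ^ 2 * log h :=
    (isBigO_refl _ _).mul ((((isBigO_refl log _).const_mul_left _).add
      ((isBigO_const_const _ one_ne_zero _).trans isBigO_one_log)).add
      ((isBigO_const_const _ one_ne_zero _).trans isBigO_one_log))
  simp only [one_mul] at hdiff
  refine ((hbounded (f := fun h => (1 - h)⁻¹) ?_).mul ((hdiff.sub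
    (hmean.trans isBigO_sq_sq_mul_log)).add hlog)).congr' ?_ (.of_eq (by simp))
  · exact ContinuousAt.inv₀ (by fun_prop) (by norm_num)
  · filter_upwards [Ioo_mem_nhdsGT (zero_lt_one' ℝ)] with h hh
    have ha : 1 - h ≠ 0 := by linarith [hh.2]
    field_simp
    ring

/-- The substitution carrying the integrals over `[-1, -3 + 2 * √2]` that define the coefficients
to integrals over `[0, π]`: `-zParam β` is the massless decay root at the frequency `β`. -/
def zParam (β : ℝ) : ℝ := -decayRoot (sin (β / 2))

theorem zParam_neg (β : ℝ) : zParam β < 0 := neg_lt_zero.2 (decayRoot_pos _)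

theorem zParam_zero : zParam 0 = -1 := by simp [zParam, decayRoot_zero]

theorem zParam_pi : zParam π = -3 + 2 * √2 := by
  have hadd := inv_decayRoot_add 1
  have hsub := inv_decayRoot_sub 1
  norm_num at hadd hsub
  rw [zParam, sin_pi_div_two]
  linarith

theorem hasDerivAt_sin_half (β : ℝ) :
    HasDerivAt (fun β => sin (β / 2)) (cos (β / 2) * (1 / 2)) β :=
  ((hasDerivAt_id' β).div_const 2).sin

theorem hasDerivAt_zParam (β : ℝ) : HasDerivAt zParam
    (decayRoot (sin (β / 2)) * cos (β / 2) / √(1 + sin (β / 2) ^ 2)) β :=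
  ((hasDerivAt_decayRoot _).comp β (hasDerivAt_sin_half β)).neg.congr_deriv (by ring)

theorem integral_eq_integral_zParam {f g : ℝ → ℝ}
    (hfg : ∀ β ∈ Ioo 0 π,
      decayRoot (sin (β / 2)) * cos (β / 2) / √(1 + sin (β / 2) ^ 2) * f (zParam β) = g β) :
    ∫ z in (-1)..(-3 + 2 * √2), f z = ∫ β in 0..π, g β := by
  rw [← zParam_zero, ← zParam_pi, ← intervalIntegral.integral_deriv_smul_comp_of_deriv_nonneg
    (fun β _ => (hasDerivAt_zParam β).continuousAt.continuousWithinAt)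
    (fun β _ => hasDerivAt_zParam β) fun β hβ => ?_]
  · refine intervalIntegral.integral_congr_Ioo_of_le pi_pos.le fun β hβ => ?_
    exact hfg β hβ
  · rw [min_eq_left pi_pos.le, max_eq_right pi_pos.le] at hβ
    exact div_nonneg (mul_nonneg (decayRoot_pos _).le (cos_half_nonneg (Ioo_subset_Icc_self hβ)))
      (sqrt_nonneg _)

/-- The cosine of the angle `β` with `zParam β = z`. -/
def cosAngle (z : ℝ) : ℝ := (4 * z + z ^ 2 + 1) / (2 * z)

theorem cosAngle_zParam (β : ℝ) : cosAngle (zParam β) = cos β := by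
  have hpos := decayRoot_pos (sin (β / 2))
  have hsum := inv_decayRoot_add (sin (β / 2))
  have hcos : cos β = 1 - 2 * sin (β / 2) ^ 2 := by
    rw [← cos_two_mul_eq_one_sub, mul_div_cancel₀ _ two_ne_zero]
  rw [cosAngle, zParam, hcos, div_eq_iff (by linarith)]
  field_simp at hsum
  linear_combination hsum

theorem theta_eq_neg_circleMap {z : ℝ} (hz : z < 0) (hlo : -1 ≤ cosAngle z) (hhi : cosAngle z ≤ 1) :
    theta z = -circleMap 0 1 (arccos (cosAngle z)) := by
  have hquad : 4 * z + z ^ 2 + 1 = 2 * z * cosAngle z := by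
    rw [cosAngle, mul_div_cancel₀ _ (by linarith)]
  have hroot : √(4 * z ^ 2 - (2 * z * cosAngle z) ^ 2) = -(2 * z) * √(1 - cosAngle z ^ 2) := by
    rw [show 4 * z ^ 2 - (2 * z * cosAngle z) ^ 2 = (-(2 * z)) ^ 2 * (1 - cosAngle z ^ 2) by ring,
      sqrt_mul (sq_nonneg _), sqrt_sq (by linarith)]
  have hquadC : 4 * (z : ℂ) + (z : ℂ) ^ 2 + 1 = 2 * z * cosAngle z := by exact_mod_cast hquad
  have hz0 : (z : ℂ) ≠ 0 := by exact_mod_cast hz.ne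
  rw [theta, hquadC, hquad, hroot, circleMap_zero, Complex.exp_mul_I, ← Complex.ofReal_cos,
    ← Complex.ofReal_sin, cos_arccos hlo hhi, sin_arccos]
  push_cast
  field_simp
  ring

theorem kFun_eq_cos (v : ℤ) {z : ℝ} (hz : z < 0) (hlo : -1 ≤ cosAngle z) (hhi : cosAngle z ≤ 1) :
    kFun v z = (-1) ^ v * cos (v * arccos (cosAngle z)) := by
  have hsign : ((-1 : ℂ)⁻¹) ^ v = (-1) ^ v := by rw [inv_neg_one]
  have hcircle := circleMap_zpow_add_inv v (arccos (cosAngle z))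
  have hreal : (theta z ^ v + theta z ^ (-v)) / 2 =
      (((-1) ^ v * cos (v * arccos (cosAngle z)) : ℝ) : ℂ) := by
    rw [theta_eq_neg_circleMap hz hlo hhi, zpow_neg, ← inv_zpow, neg_eq_neg_one_mul, mul_inv,
      mul_zpow, mul_zpow, hsign]
    push_cast at hcircle ⊢
    linear_combination (-1) ^ v / 2 * hcircle
  rw [kFun, hreal, Complex.ofReal_re]

theorem kFun_zParam (v : ℤ) {β : ℝ} (hβ : β ∈ Icc 0 π) :
    kFun v (zParam β) = (-1) ^ v * cos (v * β) := by
  have hcos := cosAngle_zParam β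
  rw [kFun_eq_cos v (zParam_neg β) (hcos ▸ neg_one_le_cos β) (hcos ▸ cos_le_one β), hcos,
    arccos_cos hβ.1 hβ.2]

theorem differentiableAt_kFun (v : ℤ) {z : ℝ} (hz : z < 0) (hlo : -1 < cosAngle z)
    (hhi : cosAngle z < 1) : DifferentiableAt ℝ (kFun v) z := by
  have hcosAngle : DifferentiableAt ℝ cosAngle z :=
    DifferentiableAt.div (by fun_prop) (by fun_prop) (by linarith)
  have harccos : DifferentiableAt ℝ (fun z => arccos (cosAngle z)) z :=
    (differentiableAt_arccos.2 ⟨hlo.ne', hhi.ne⟩).comp z hcosAngle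
  have hlocal : kFun v =ᶠ[𝓝 z] fun z => (-1) ^ v * cos (v * arccos (cosAngle z)) := by
    filter_upwards [eventually_lt_nhds hz, hcosAngle.continuousAt.eventually_const_lt hlo,
      hcosAngle.continuousAt.eventually_lt_const hhi] with t ht htlo hthi
    exact kFun_eq_cos v ht htlo.le hthi.le
  exact (((harccos.const_mul _).cos).const_mul _).congr_of_eventuallyEq hlocal

theorem hasDerivAt_cos_mul (v β : ℝ) :
    HasDerivAt (fun β => cos (v * β)) (-(v * sin (v * β))) β :=
  ((hasDerivAt_id' β).const_mul v).cos.congr_deriv (by ring)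

theorem deriv_kFun_zParam (v : ℤ) {β : ℝ} (hβ : β ∈ Ioo 0 π) :
    decayRoot (sin (β / 2)) * cos (β / 2) / √(1 + sin (β / 2) ^ 2) * deriv (kFun v) (zParam β) =
      -((-1) ^ v * (v * sin (v * β))) := by
  have hcos := cosAngle_zParam β
  have hlt : cosAngle (zParam β) < 1 := by
    rw [hcos, ← cos_zero]
    exact cos_lt_cos_of_nonneg_of_le_pi le_rfl hβ.2.le hβ.1
  have hgt : -1 < cosAngle (zParam β) := by
    rw [hcos, ← cos_pi]
    exact cos_lt_cos_of_nonneg_of_le_pi hβ.1.le le_rfl hβ.2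
  have hchain := (differentiableAt_kFun v (zParam_neg β) hgt hlt).hasDerivAt.comp β
    (hasDerivAt_zParam β)
  have hlocal : kFun v ∘ zParam =ᶠ[𝓝 β] fun β => (-1) ^ v * cos (v * β) := by
    filter_upwards [isOpen_Ioo.mem_nhds hβ] with t ht
    exact kFun_zParam v (Ioo_subset_Icc_self ht)
  rw [mul_comm, ← mul_neg]
  exact hchain.unique (((hasDerivAt_cos_mul v β).const_mul _).congr_of_eventuallyEq hlocal)

theorem sqrt_zParam {β : ℝ} (hβ : β ∈ Icc 0 π) :
    √(-1 - 6 * zParam β - zParam β ^ 2) = 2 * exp (-arsinh (sin (β / 2))) * cos (β / 2) := by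
  have hcos := cos_half_nonneg hβ
  have hsub := one_sub_decayRoot (sin (β / 2))
  have hroot : decayRoot (sin (β / 2)) = exp (-arsinh (sin (β / 2))) ^ 2 := by
    rw [decayRoot, ← exp_nat_mul]; congr 1; push_cast; ring
  rw [← sqrt_sq (by positivity : 0 ≤ 2 * exp (-arsinh (sin (β / 2))) * cos (β / 2)), zParam,
    mul_pow, cos_sq', mul_pow, ← hroot]
  congr 1
  linear_combination -(1 - decayRoot (sin (β / 2)) + 2 * sin (β / 2) *
    exp (-arsinh (sin (β / 2)))) * hsub + 4 * sin (β / 2) ^ 2 * hroot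

theorem deriv_zParam_div_sqrt {β : ℝ} (hβ : β ∈ Ioo 0 π) :
    decayRoot (sin (β / 2)) * cos (β / 2) / √(1 + sin (β / 2) ^ 2) /
      √(-1 - 6 * zParam β - zParam β ^ 2) =
      decayRoot (sin (β / 2)) / (1 + decayRoot (sin (β / 2))) := by
  have hcos : 0 < cos (β / 2) :=
    cos_pos_of_mem_Ioo ⟨by linarith [hβ.1, pi_pos], by linarith [hβ.2]⟩
  rw [sqrt_zParam (Ioo_subset_Icc_self hβ), one_add_decayRoot]
  field_simp

theorem integral_kFun_div_sqrt (P : ℝ → ℝ) (v : ℤ) :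
    ∫ z in (-1)..(-3 + 2 * √2), P (-z) * (kFun v z / √(-1 - 6 * z - z ^ 2)) =
      (-1) ^ v * cosTransform (fun r => P r * (r / (1 + r))) v 0 := by
  rw [cosTransform, ← intervalIntegral.integral_const_mul]
  refine integral_eq_integral_zParam fun β hβ => ?_
  have hβ' := Ioo_subset_Icc_self hβ
  rw [kFun_zParam v hβ', dispersion_zero hβ', ← deriv_zParam_div_sqrt hβ, zParam, neg_neg]
  ring

/-- Minus the function `bFun` in the coordinate `zParam`. -/
def logProfile (β : ℝ) : ℝ :=
  1 / 2 * (log (4 * √2) + log (sin (β / 2)) - log (√(1 + sin (β / 2) ^ 2) + cos (β / 2)))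

theorem sqrt_add_cos_half_pos {β : ℝ} (hβ : β ∈ Icc 0 π) :
    0 < √(1 + sin (β / 2) ^ 2) + cos (β / 2) :=
  add_pos_of_pos_of_nonneg (sqrt_pos.2 (by positivity)) (cos_half_nonneg hβ)

theorem bFun_zParam {β : ℝ} (hβ : β ∈ Ioc 0 π) : bFun (zParam β) = -logProfile β := by
  have hβ' := Ioc_subset_Icc_self hβ
  have hsin := sin_half_pos hβ
  have hden := sqrt_add_cos_half_pos hβ'
  have hquot : 4 * √2 * (1 + zParam β) / (1 - zParam β + √(-1 - 6 * zParam β - zParam β ^ 2)) =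
      4 * √2 * sin (β / 2) / (√(1 + sin (β / 2) ^ 2) + cos (β / 2)) := by
    rw [sqrt_zParam hβ', zParam, ← sub_eq_add_neg, sub_neg_eq_add, one_sub_decayRoot,
      one_add_decayRoot]
    field_simp
  rw [bFun, hquot, log_div (by positivity) hden.ne', log_mul (by positivity) hsin.ne', logProfile]
  ring

theorem integral_deriv_kFun_mul_bFun (v : ℤ) :
    ∫ z in (-1)..(-3 + 2 * √2), deriv (kFun v) z * bFun z =
      (-1) ^ v * ∫ β in 0..π, v * sin (v * β) * logProfile β := by
  rw [← intervalIntegral.integral_const_mul]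
  refine integral_eq_integral_zParam fun β hβ => ?_
  rw [← mul_assoc, deriv_kFun_zParam v hβ, bFun_zParam (Ioo_subset_Ioc_self hβ)]
  ring

theorem log_four_mul_sqrt_two : log (4 * √2) = 5 / 2 * log 2 := by
  rw [log_mul (by norm_num) (by positivity), log_sqrt (by norm_num),
    show (4 : ℝ) = 2 ^ 2 by norm_num, log_pow]
  push_cast
  ring

/-- The singular term is absent from this value because `log 0 = 0`. -/
theorem logProfile_zero : logProfile 0 = 3 / 4 * log 2 := by
  rw [logProfile, log_four_mul_sqrt_two]
  norm_num
  ring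

theorem logProfile_pi : logProfile π = log 2 := by
  rw [logProfile, log_four_mul_sqrt_two, sin_pi_div_two, cos_pi_div_two, log_one, one_pow,
    one_add_one_eq_two, add_zero, add_zero, log_sqrt (by norm_num)]
  ring

theorem hasDerivAt_logProfile {β : ℝ} (hβ : β ∈ Ioc 0 π) :
    HasDerivAt logProfile ((4 * sin (β / 2))⁻¹ / √(1 + sin (β / 2) ^ 2)) β := by
  have hsin := sin_half_pos hβ
  have hroot : 0 < √(1 + sin (β / 2) ^ 2) := sqrt_pos.2 (by positivity)
  have hden := sqrt_add_cos_half_pos (Ioc_subset_Icc_self hβ)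
  have hrootSq : √(1 + sin (β / 2) ^ 2) ^ 2 = 1 + sin (β / 2) ^ 2 := sq_sqrt (by positivity)
  have hderivRoot := (((hasDerivAt_sin_half β).pow 2).const_add 1).sqrt (sqrt_pos.1 hroot).ne'
  have hderivCos := ((hasDerivAt_id' β).div_const 2).cos
  refine (((((hasDerivAt_sin_half β).log hsin.ne').const_add (log (4 * √2))).sub
    ((hderivRoot.add hderivCos).log hden.ne')).const_mul (1 / 2)).congr_deriv ?_
  simp only [Pi.add_apply, Pi.pow_apply]
  field_simp
  linear_combination 8 * cos (β / 2) * hrootSq +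
    8 * √(1 + sin (β / 2) ^ 2) * sin_sq_add_cos_sq (β / 2)

theorem continuousOn_log_sqrt_add_cos_half :
    ContinuousOn (fun β => log (√(1 + sin (β / 2) ^ 2) + cos (β / 2))) (Icc 0 π) :=
  ContinuousOn.log (by fun_prop) fun _ hβ => (sqrt_add_cos_half_pos hβ).ne'

theorem intervalIntegrable_logProfile :
    IntervalIntegrable logProfile MeasureTheory.volume 0 π := by
  have hlogSin : IntervalIntegrable (fun β => log (sin (β / 2))) MeasureTheory.volume 0 π := by
    have hcomp := (intervalIntegrable_log_sin (a := 0) (b := π / 2)).comp_mul_left (c := 1 / 2)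
    simpa [div_eq_inv_mul] using hcomp
  exact ((intervalIntegrable_const.add hlogSin).sub
    (continuousOn_log_sqrt_add_cos_half.intervalIntegrable_of_Icc pi_pos.le)).const_mul _

theorem continuousOn_cos_sub_one_mul_log (v : ℤ) :
    ContinuousOn (fun β => (cos (v * β) - 1) * log (sin (β / 2))) (Icc 0 π) := by
  intro β hβ
  obtain rfl | hpos := hβ.1.eq_or_lt
  · have hbound : Continuous fun β : ℝ =>
        (v : ℝ) ^ 2 * π ^ 2 * (|sin (β / 2)| * |sin (β / 2) * log (sin (β / 2))|) := by
      have := continuous_mul_log.comp (by fun_prop : Continuous fun β : ℝ => sin (β / 2))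
      exact continuous_const.mul
        ((by fun_prop : Continuous fun β : ℝ => |sin (β / 2)|).mul this.abs)
    have hlim := (hbound.tendsto 0).mono_left (nhdsWithin_le_nhds (s := Icc 0 π))
    simp only [zero_div, sin_zero, abs_zero, zero_mul, mul_zero] at hlim
    have hzero : (cos (v * 0) - 1) * log (sin (0 / 2)) = 0 := by simp
    rw [ContinuousWithinAt, hzero]
    refine squeeze_zero_norm' ?_ hlim
    filter_upwards [self_mem_nhdsWithin] with t ht
    rw [norm_eq_abs, abs_mul, abs_sub_comm, abs_mul (sin _), ← mul_assoc |sin _|, abs_mul_abs_self,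
      ← pow_two, ← mul_assoc]
    gcongr
    exact abs_one_sub_cos_mul_le v ht
  · refine ContinuousAt.continuousWithinAt (ContinuousAt.mul (by fun_prop) ?_)
    exact ContinuousAt.log (by fun_prop) (sin_half_pos ⟨hpos, hβ.2⟩).ne'

theorem continuousOn_cos_mul_logProfile_sub (v : ℤ) :
    ContinuousOn (fun β => cos (v * β) * logProfile β - 1 / 2 * log (sin (β / 2))) (Icc 0 π) := by
  have hcont := (continuousOn_const (c := (1 / 2 : ℝ))).mul
    ((continuousOn_cos_sub_one_mul_log v).add ((by fun_prop : Continuous fun β : ℝ =>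
      cos (v * β)).continuousOn.mul
        ((continuousOn_const (c := log (4 * √2))).sub continuousOn_log_sqrt_add_cos_half)))
  refine hcont.congr fun β _ => ?_
  simp only [logProfile, Pi.mul_apply, Pi.add_apply, Pi.sub_apply]
  ring

/-- Integration by parts: `logProfile` is a primitive of the singular kernel of `regularPart`. -/
theorem regularPart_eq (v : ℤ) : regularPart v =
    (-1) ^ v * log 2 - 3 / 4 * log 2 + ∫ β in 0..π, v * sin (v * β) * logProfile β := by
  have hprofile : IntervalIntegrable (fun β => v * sin (v * β) * logProfile β)
      MeasureTheory.volume 0 π :=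
    intervalIntegrable_logProfile.continuousOn_mul (by fun_prop)
  have hderiv : ∀ β ∈ Ioo 0 π, HasDerivAt
      (fun β => cos (v * β) * logProfile β - 1 / 2 * log (sin (β / 2)))
      ((4 * sin (β / 2))⁻¹ * (cos (v * β) / √(1 + sin (β / 2) ^ 2) - cos (β / 2)) -
        v * sin (v * β) * logProfile β) β := by
    intro β hβ
    have hβ' := Ioo_subset_Ioc_self hβ
    have hsin := sin_half_pos hβ'
    refine (((hasDerivAt_cos_mul v β).mul (hasDerivAt_logProfile hβ')).sub
      (((hasDerivAt_sin_half β).log hsin.ne').const_mul (1 / 2))).congr_deriv ?_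
    rw [mul_inv]
    ring
  have hparts := intervalIntegral.integral_eq_sub_of_hasDerivAt_of_le pi_pos.le
    (continuousOn_cos_mul_logProfile_sub v) hderiv ((intervalIntegrable_regularPart v).sub hprofile)
  rw [intervalIntegral.integral_sub (intervalIntegrable_regularPart v) hprofile, ← regularPart,
    logProfile_zero, logProfile_pi, cos_int_mul_pi] at hparts
  simp only [mul_zero, cos_zero, zero_div, sin_zero, log_zero, sin_pi_div_two, log_one] at hparts
  linear_combination hparts

theorem regularPart_add (v : ℤ) : regularPart v + 3 / 4 * log 2 = (-1) ^ v * (log 2 +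
    ∫ z in (-1)..(-3 + 2 * √2), deriv (kFun v) z * bFun z) := by
  rw [integral_deriv_kFun_mul_bFun, regularPart_eq, mul_add, ← mul_assoc, ← mul_zpow]
  norm_num
  ring

theorem c0Odd_eq {p : ℤ} {n : ℕ} (hp : p.natAbs = 2 * n + 1) (v : ℤ) :
    c0Odd p (2 * v) = (-1) ^ n * (-1) ^ v / π * cosTransform (diffWeight n) v 0 := by
  have hn : (p.natAbs - 1) / 2 = n := by omega
  have hv : 2 * v / 2 = v := by omega
  have hpow (z : ℝ) : z ^ n * kFun v z / √(-1 - 6 * z - z ^ 2) =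
      (-1) ^ n * ((-z) ^ n * (kFun v z / √(-1 - 6 * z - z ^ 2))) := by
    rw [← mul_assoc, ← mul_pow, neg_one_mul, neg_neg, mul_div_assoc]
  rw [c0Odd, hn, hv]
  simp only [hpow]
  rw [intervalIntegral.integral_const_mul, integral_kFun_div_sqrt fun r => r ^ n,
    show (fun r : ℝ => r ^ n * (r / (1 + r))) = diffWeight n from rfl]
  ring

theorem c2Odd_eq {p : ℤ} {n : ℕ} (hp : p.natAbs = 2 * n + 1) (v : ℤ) :
    c2Odd p (2 * v) = 1 / π * meanCoeff n v := by
  have hn : (p.natAbs - 1) / 2 = n := by omega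
  have hv : 2 * v / 2 = v := by omega
  have hsign : ((-1 : ℝ) ^ v) * (-1) ^ v = 1 := by rw [← mul_zpow]; norm_num
  rw [c2Odd, hn, hv, integral_kFun_div_sqrt fun r => 1 / 2 * r ^ n + ∑ i ∈ Finset.range n, r ^ i,
    show (fun r : ℝ => (1 / 2 * r ^ n + ∑ i ∈ Finset.range n, r ^ i) * (r / (1 + r))) =
      meanWeight n from rfl, meanCoeff, regularPart_add]
  linear_combination 1 / π * cosTransform (meanWeight n) v 0 * hsign

theorem latticeEntry_eq {a : ℝ} (ha : 0 < a) (ha' : a < 1) (k l : ℤ) : latticeEntry a k l =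
    ((-1) ^ (k + l) / π * (massiveGreen (mass a) k.natAbs l -
      massiveGreen (mass a) (k + 1).natAbs l / a) : ℝ) := by
  rw [latticeEntry, latticeGreen_eq ha ha', latticeGreen_eq ha ha', add_right_comm k 1 l,
    zpow_add_one₀ (by norm_num), ← Complex.ofReal_mul, ← Complex.ofReal_add]
  congr 1
  field_simp
  ring

/-- The expansion to first order in `h`, without the phase `Σ` and for the sign `ζ`, of the entry
at the displacement `p e₁ + q e₂` with `p` odd and `q` even. -/
def mainTerm (h ζ : ℝ) (p q : ℤ) : ℝ :=
  c0Odd p q + c0Odd p q * h / 2 + ζ * (1 / (2 * π) * h * log h + c2Odd p q * h)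

theorem mainTerm_congr_natAbs (h ζ : ℝ) {p p' : ℤ} (hp : p.natAbs = p'.natAbs) (q : ℤ) :
    mainTerm h ζ p q = mainTerm h ζ p' q := by
  simp only [mainTerm, c0Odd, c2Odd, hp]

/-- The error of the expansion to first order in `h = 1 - a` of the entries of the inverse
Kasteleyn matrix, in lattice coordinates. -/
def remainder (k l : ℤ) (h : ℝ) : ℂ :=
  latticeEntry (1 - h) k l - mainTerm h ((-1) ^ (k + l)) (2 * k + 1) (2 * l)

/-- Separates the bounded difference from the logarithmically divergent mean of two consecutive
values, uniformly in the direction in which `|k|` changes. -/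
theorem exists_sub_div_eq (k : ℤ) : ∃ (n : ℕ) (s : ℝ),
    (2 * k + 1).natAbs = 2 * n + 1 ∧ (-1) ^ n = s * (-1 : ℝ) ^ k ∧ ∀ (g : ℕ → ℝ) {h : ℝ}, h ≠ 1 →
      g k.natAbs - g (k + 1).natAbs / (1 - h) = (1 - h)⁻¹ *
        (s * (1 - h / 2) * (g n - g (n + 1)) - h * ((g n + g (n + 1)) / 2)) := by
  have hcancel {h : ℝ} (hh : h ≠ 1) : 1 - h ≠ 0 := sub_ne_zero.2 hh.symm
  obtain n | n := k
  · refine ⟨n, 1, by simp; omega, by simp, fun g h hh => ?_⟩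
    have := hcancel hh
    rw [show (Int.ofNat n).natAbs = n from rfl, show (Int.ofNat n + 1).natAbs = n + 1 from rfl]
    field_simp
    ring
  · refine ⟨n, -1, by omega, ?_, fun g h hh => ?_⟩
    · rw [zpow_negSucc, ← inv_pow, inv_neg_one, pow_succ]
      ring
    · have := hcancel hh
      rw [show (Int.negSucc n).natAbs = n + 1 from rfl,
        show (Int.negSucc n + 1).natAbs = n by omega]
      field_simp
      ring

theorem isBigO_remainder (k l : ℤ) : remainder k l =O[𝓝[>] 0] fun h => h ^ 2 * log h := by
  obtain ⟨n, s, hn, hsign, hcomb⟩ := exists_sub_div_eq k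
  have hmain := (isBigO_massiveGreen_combination s n l).const_mul_left ((-1) ^ (k + l) / π)
  refine ((Complex.isBigO_ofReal_left.2 hmain).congr' ?_ .rfl :)
  filter_upwards [Ioo_mem_nhdsGT (zero_lt_one' ℝ)] with h hh
  rw [remainder, latticeEntry_eq (by linarith [hh.2]) (by linarith [hh.1]), mainTerm, c0Odd_eq hn,
    c2Odd_eq hn, hsign, hcomb (fun j => massiveGreen (mass (1 - h)) j l) hh.2.ne,
    zpow_add₀ (by norm_num), ← Complex.ofReal_sub]
  congr 1
  field_simp

theorem smul_e1_add_smul_e2 (p q : ℤ) : p • e1 + q • e2 = (p - q, p + q) := by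
  ext <;> simp [e1, e2, sub_eq_add_neg]

theorem planeInverse_eq_torusIntegral (a H V : ℝ) {x y : ℤ × ℤ} {ε₁ ε₂ : Fin 2} {u v : ℤ}
    (hx : vertexType x = ε₁) (hy : vertexType y = ε₂)
    (hxy : y = x + domainOffset ε₁ ε₂ + (2 * u) • e1 + (2 * v) • e2) :
    planeInverse a H V x y = torusIntegral a H V ε₁ ε₂ u v := by
  have hsub : y - x - domainOffset ε₁ ε₂ = (2 * u) • e1 + (2 * v) • e2 := by rw [hxy]; abel
  rw [planeInverse, hx, hy, hsub]
  rw [smul_e1_add_smul_e2]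
  congr 1 <;> omega

theorem vertexType_cases {x : ℤ × ℤ} (hx : Odd (x.1 + x.2)) :
    vertexType x = 0 ∧ (x.1 + x.2) % 4 = 1 ∨ vertexType x = 1 ∧ (x.1 + x.2) % 4 = 3 := by
  rw [Int.odd_iff] at hx
  rw [vertexType]
  split_ifs with hmod
  · exact Or.inl ⟨rfl, hmod⟩
  · exact Or.inr ⟨rfl, by omega⟩

theorem sigmaPhase_of_odd_even {x y : ℤ × ℤ} {k l : ℤ}
    (hxy : y = x + (2 * k + 1) • e1 + (2 * l) • e2) : sigmaPhase x y = 1 :=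
  if_pos ⟨k, l, hxy⟩

theorem sigmaPhase_of_even_odd {x y : ℤ × ℤ} {k l : ℤ}
    (hxy : y = x + (2 * k) • e1 + (2 * l + 1) • e2) : sigmaPhase x y = Complex.I := by
  rw [sigmaPhase, if_neg, if_pos ⟨k, l, hxy⟩]
  rintro ⟨k', l', hxy'⟩
  have hp := congrArg coordP (add_left_cancel ((add_assoc x _ _).symm.trans
    (hxy.symm.trans (hxy'.trans (add_assoc x _ _)))))
  rw [(coord_eq _ _).1, (coord_eq _ _).1] at hp
  omega

theorem symmetrize_of_odd_even (F : ℤ → ℤ → ℝ) {p q : ℤ} (hp : Odd p) (hq : Even q) :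
    symmetrize F (p • e1 + q • e2) = F p q := by
  rw [symmetrize, (coord_eq p q).1, (coord_eq p q).2, if_pos ⟨hp, hq⟩]

theorem symmetrize_of_even_odd (F : ℤ → ℤ → ℝ) {p q : ℤ} (hp : Even p) (hq : Odd q) :
    symmetrize F (p • e1 + q • e2) = F q p := by
  rw [symmetrize, (coord_eq p q).1, (coord_eq p q).2,
    if_neg fun hpq => Int.not_odd_iff_even.2 hp hpq.1, if_pos ⟨hp, hq⟩]

theorem zetaSign_eq {x y : ℤ × ℤ} {j : ℤ} (hj : (y.2 - x.1 - 2 * j) % 4 = 0) :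
    zetaSign x y = (-1) ^ j := by
  obtain ⟨i, hi⟩ : ∃ i, (y.2 - x.1) / 2 = j + 2 * i := ⟨(y.2 - x.1 - 2 * j) / 4, by omega⟩
  rw [zetaSign, hi, zpow_add₀ (by norm_num), zpow_mul]
  norm_num

/-- The expansion to first order in `h = 1 - a` of the entry at `(x, y)`, without the phase `Σ`. -/
def entryExpansion (h : ℝ) (x y : ℤ × ℤ) : ℝ :=
  c0 (y - x) + c0 (y - x) * h / 2 +
    zetaSign x y * (c1 (y - x) * h * log h + c2 (y - x) * h)

theorem entryExpansion_of_odd_even (h : ℝ) {x y : ℤ × ℤ} {p q : ℤ} (hp : Odd p) (hq : Even q)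
    (hxy : y = x + p • e1 + q • e2) :
    entryExpansion h x y = mainTerm h (zetaSign x y) p q := by
  have hsub : y - x = p • e1 + q • e2 := by rw [hxy]; abel
  simp only [entryExpansion, mainTerm, hsub, c0, c1, c2, symmetrize_of_odd_even _ hp hq]

theorem entryExpansion_of_even_odd (h : ℝ) {x y : ℤ × ℤ} {p q : ℤ} (hp : Even p) (hq : Odd q)
    (hxy : y = x + p • e1 + q • e2) :
    entryExpansion h x y = mainTerm h (zetaSign x y) q p := by
  have hsub : y - x = p • e1 + q • e2 := by rw [hxy]; abel
  simp only [entryExpansion, mainTerm, hsub, c0, c1, c2, symmetrize_of_even_odd _ hp hq]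

theorem exists_eq_add_domainOffset {x y : ℤ × ℤ} (hx : IsWhite x) (hy : IsBlack y) :
    ∃ u v : ℤ,
      y = x + domainOffset (vertexType x) (vertexType y) + (2 * u) • e1 + (2 * v) • e2 := by
  obtain ⟨⟨i, hi⟩, ⟨j, hj⟩⟩ := hx
  obtain ⟨⟨k, hk⟩, ⟨l, hl⟩⟩ := hy
  refine ⟨((y - x - domainOffset (vertexType x) (vertexType y)).1 +
      (y - x - domainOffset (vertexType x) (vertexType y)).2) / 4,
    ((y - x - domainOffset (vertexType x) (vertexType y)).2 -
      (y - x - domainOffset (vertexType x) (vertexType y)).1) / 4, Prod.ext ?_ ?_⟩ <;>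
  rcases vertexType_cases (x := x) (by rw [Int.odd_iff]; omega) with ⟨hx, hxmod⟩ | ⟨hx, hxmod⟩ <;>
  rcases vertexType_cases (x := y) (by rw [Int.odd_iff]; omega) with ⟨hy, hymod⟩ | ⟨hy, hymod⟩ <;>
  simp [hx, hy, domainOffset, e1, e2] <;> omega

/-- Reduction of an entry and of its expansion to the lattice coordinates `(j, l)`. -/
structure HasLatticeCoords (x y : ℤ × ℤ) (j l : ℤ) : Prop where
  norm_sigmaPhase : ‖sigmaPhase x y‖ = 1
  zetaSign_eq : zetaSign x y = (-1) ^ (j + l)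
  entryExpansion_eq (h : ℝ) :
    entryExpansion h x y = mainTerm h (zetaSign x y) (2 * j + 1) (2 * l)
  planeInverse_eq {a : ℝ} (ha : 0 < a) (ha' : a < 1) :
    planeInverse a 0 0 x y = 1 / sigmaPhase x y * latticeEntry a j l

theorem HasLatticeCoords.norm_planeInverse_sub {x y : ℤ × ℤ} {j l : ℤ} {h : ℝ}
    (hxy : HasLatticeCoords x y j l) (hh : 0 < h) (hh' : h < 1) :
    ‖planeInverse (1 - h) 0 0 x y - 1 / sigmaPhase x y * (entryExpansion h x y : ℂ)‖ =
      ‖remainder j l h‖ := by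
  rw [hxy.planeInverse_eq (by linarith) (by linarith), hxy.entryExpansion_eq, hxy.zetaSign_eq,
    ← mul_sub, norm_mul, norm_div, norm_one, hxy.norm_sigmaPhase, div_one, one_mul, remainder]

theorem HasLatticeCoords.of_odd_even {x y : ℤ × ℤ} {p j l : ℤ}
    (hxy : y = x + p • e1 + (2 * l) • e2) (hp : p.natAbs = (2 * j + 1).natAbs)
    (hζ : (y.2 - x.1 - 2 * (j + l)) % 4 = 0)
    (hentry : ∀ {a : ℝ}, 0 < a → a < 1 → planeInverse a 0 0 x y = latticeEntry a j l) :
    HasLatticeCoords x y j l := by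
  obtain ⟨k, rfl⟩ : Odd p := by rw [Int.odd_iff]; omega
  have hphase := sigmaPhase_of_odd_even hxy
  refine ⟨by rw [hphase, norm_one], TwoPeriodicAztec.zetaSign_eq hζ, fun h => ?_, fun ha ha' => ?_⟩
  · rw [entryExpansion_of_odd_even h (odd_two_mul_add_one k) (even_two_mul l) hxy,
      mainTerm_congr_natAbs _ _ hp]
  · rw [hentry ha ha', hphase, div_one, one_mul]

theorem HasLatticeCoords.of_even_odd {x y : ℤ × ℤ} {q j l : ℤ}
    (hxy : y = x + (2 * l) • e1 + q • e2) (hq : q.natAbs = (2 * j + 1).natAbs)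
    (hζ : (y.2 - x.1 - 2 * (j + l)) % 4 = 0)
    (hentry : ∀ {a : ℝ}, 0 < a → a < 1 →
      planeInverse a 0 0 x y = 1 / Complex.I * latticeEntry a j l) :
    HasLatticeCoords x y j l := by
  obtain ⟨k, rfl⟩ : Odd q := by rw [Int.odd_iff]; omega
  have hphase := sigmaPhase_of_even_odd hxy
  refine ⟨by rw [hphase, Complex.norm_I], TwoPeriodicAztec.zetaSign_eq hζ, fun h => ?_,
    fun ha ha' => ?_⟩
  · rw [entryExpansion_of_even_odd h (even_two_mul l) (odd_two_mul_add_one k) hxy,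
      mainTerm_congr_natAbs _ _ hq]
  · rw [hentry ha ha', hphase]

theorem exists_hasLatticeCoords {x y : ℤ × ℤ} (hx : IsWhite x) (hy : IsBlack y) {R : ℤ}
    (hR₁ : |y.1 - x.1| ≤ R) (hR₂ : |y.2 - x.2| ≤ R) :
    ∃ j ∈ Finset.Icc (-(R + 1)) (R + 1), ∃ l ∈ Finset.Icc (-(R + 1)) (R + 1),
      HasLatticeCoords x y j l := by
  obtain ⟨u, v, hxy⟩ := exists_eq_add_domainOffset hx hy
  obtain ⟨⟨hx₁, hx₂⟩, ⟨hy₁, hy₂⟩⟩ := hx, hy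
  rw [Int.odd_iff] at hx₁ hy₂
  rw [Int.even_iff] at hx₂ hy₁
  rw [abs_le] at hR₁ hR₂
  simp only [Finset.mem_Icc]
  rcases vertexType_cases (x := x) (by rw [Int.odd_iff]; omega) with ⟨hx, hxmod⟩ | ⟨hx, hxmod⟩ <;>
  rcases vertexType_cases (x := y) (by rw [Int.odd_iff]; omega) with ⟨hy, hymod⟩ | ⟨hy, hymod⟩ <;>
  have hentry := fun a : ℝ => planeInverse_eq_torusIntegral a 0 0 rfl rfl hxy <;>
  simp only [hx, hy] at hxy hentry <;>
  have hfst := congrArg Prod.fst hxy <;>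
  have hsnd := congrArg Prod.snd hxy <;>
  simp only [domainOffset, e1, e2, Int.reduceNeg, Prod.neg_mk, neg_neg, Fin.isValue,
    Matrix.of_apply, Matrix.cons_val', Matrix.cons_val_zero, Matrix.cons_val_one,
    Matrix.cons_val_fin_one, Prod.smul_mk, Int.zsmul_eq_mul, mul_one, mul_neg, Prod.fst_add,
    Prod.snd_add] at hfst hsnd
  · refine ⟨v, by omega, u, by omega, .of_even_odd (q := 2 * v + 1) ?_ rfl (by omega)
      fun ha ha' => (hentry _).trans (torusIntegral_zero_zero ha ha' u v)⟩
    rw [hxy]; ext <;> simp [domainOffset, e1, e2] <;> ring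
  · refine ⟨u, by omega, v, by omega, .of_odd_even (p := 2 * u + 1) ?_ rfl (by omega)
      fun ha ha' => (hentry _).trans (torusIntegral_zero_one ha ha' u v)⟩
    rw [hxy]; ext <;> simp [domainOffset, e1, e2] <;> ring
  · refine ⟨-u, by omega, v, by omega, .of_odd_even (p := 2 * u - 1) ?_ (by omega) (by omega)
      fun ha ha' => (hentry _).trans (torusIntegral_one_zero ha ha' u v)⟩
    rw [hxy]; ext <;> simp [domainOffset, e1, e2] <;> ring
  · refine ⟨-v, by omega, u, by omega, .of_even_odd (q := 2 * v - 1) ?_ (by omega) (by omega)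
      fun ha ha' => (hentry _).trans (torusIntegral_one_one ha ha' u v)⟩
    rw [hxy]; ext <;> simp [domainOffset, e1, e2] <;> ring

theorem isBigO_sum_norm_remainder (s : Finset (ℤ × ℤ)) :
    (fun h => ∑ i ∈ s, ‖remainder i.1 i.2 h‖) =O[𝓝[>] 0] fun h => h ^ 2 * log h :=
  .fun_sum fun (i : ℤ × ℤ) _ => (isBigO_remainder i.1 i.2).norm_left

theorem tendsto_smallParam {B : ℝ} (hB : 0 < B) : Tendsto (smallParam B) atTop (𝓝[>] 0) := by
  refine tendsto_nhdsWithin_iff.2 ⟨?_, ?_⟩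
  · have hpow : Tendsto (fun m : ℕ => (m : ℝ) ^ (-(1 / 2) : ℝ)) atTop (𝓝 0) :=
      (tendsto_rpow_neg_atTop (by norm_num)).comp tendsto_natCast_atTop_atTop
    exact mul_zero B ▸ hpow.const_mul B
  · filter_upwards [eventually_gt_atTop 0] with m hm
    exact mul_pos hB (rpow_pos_of_pos (Nat.cast_pos.2 hm) _)

theorem smallParam_sq (B : ℝ) (m : ℕ) : smallParam B m ^ 2 = B ^ 2 * (m : ℝ)⁻¹ := by
  rw [smallParam, mul_pow, ← rpow_mul_natCast m.cast_nonneg]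
  norm_num [rpow_neg_one]

theorem log_smallParam {B : ℝ} (hB : 0 < B) {m : ℕ} (hm : 0 < m) :
    log (smallParam B m) = log B - log m / 2 := by
  have hm' : (0 : ℝ) < m := Nat.cast_pos.2 hm
  rw [smallParam, log_mul hB.ne' (rpow_pos_of_pos hm' _).ne', log_rpow hm']
  ring

theorem isBigO_smallParam_sq_mul_log {B : ℝ} (hB : 0 < B) :
    (fun m => smallParam B m ^ 2 * log (smallParam B m)) =O[atTop]
      fun m : ℕ => (m : ℝ)⁻¹ * log m := by
  have hlog : Tendsto (fun m : ℕ => log m) atTop atTop :=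
    tendsto_log_atTop.comp tendsto_natCast_atTop_atTop
  have hconst : (fun _ : ℕ => log B) =O[atTop] fun m : ℕ => log m :=
    IsLittleO.isBigO (isLittleO_const_left.2 (Or.inr (tendsto_norm_atTop_atTop.comp hlog)))
  have hlogh : (fun m : ℕ => log B - 2⁻¹ * log m) =O[atTop] fun m : ℕ => log m :=
    hconst.sub (isBigO_const_mul_self _ _ _)
  refine ((isBigO_const_mul_self (B ^ 2) (fun m : ℕ => (m : ℝ)⁻¹) atTop).mul hlogh).congr' ?_ .rfl
  filter_upwards [eventually_gt_atTop 0] with m hm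
  rw [smallParam_sq, log_smallParam hB hm]
  ring

theorem exists_norm_remainder_smallParam_le {B : ℝ} (hB : 0 < B) (s : Finset (ℤ × ℤ)) :
    ∃ C : ℝ, ∀ᶠ m : ℕ in atTop, ∀ j l : ℤ, (j, l) ∈ s →
      ‖remainder j l (smallParam B m)‖ ≤ C * ((m : ℝ)⁻¹ * log m) := by
  obtain ⟨C, hC⟩ := (((isBigO_sum_norm_remainder s).comp_tendsto (tendsto_smallParam hB)).trans
    (isBigO_smallParam_sq_mul_log hB)).bound
  refine ⟨C, ?_⟩
  filter_upwards [hC, eventually_ge_atTop 1] with m hm hm₁ j l hjl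
  have hlog : 0 ≤ (m : ℝ)⁻¹ * log m := by positivity
  rw [norm_of_nonneg hlog] at hm
  have hsum : ‖remainder j l (smallParam B m)‖ ≤ ∑ i ∈ s, ‖remainder i.1 i.2 (smallParam B m)‖ :=
    Finset.single_le_sum (fun i _ => norm_nonneg (remainder i.1 i.2 (smallParam B m))) hjl
  exact hsum.trans ((le_norm_self _).trans hm)

end

end TwoPeriodicAztec

theorem mainTheorem5 (B : ℝ) (hB : 0 < B) (R : ℕ) :
    ∃ C : ℝ, ∀ᶠ m : ℕ in atTop, ∀ x y : ℤ × ℤ, IsWhite x → IsBlack y →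
      |y.1 - x.1| ≤ (R : ℤ) → |y.2 - x.2| ≤ (R : ℤ) →
      ‖planeInverse (1 - smallParam B m) 0 0 x y -
        1 / sigmaPhase x y *
          ((c0 (y - x) + c0 (y - x) * smallParam B m / 2 +
            zetaSign x y *
              (c1 (y - x) * smallParam B m * Real.log (smallParam B m) +
                c2 (y - x) * smallParam B m) : ℝ) : ℂ)‖
        ≤ C * ((m : ℝ)⁻¹ * Real.log m) := by
  let s := Finset.Icc (-((R : ℤ) + 1)) (R + 1)
  obtain ⟨C, hC⟩ := exists_norm_remainder_smallParam_le hB (s ×ˢ s)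
  refine ⟨C, ?_⟩
  filter_upwards [hC, tendsto_smallParam hB (Ioo_mem_nhdsGT one_pos)] with m hm ⟨hpos, hlt⟩ x y
    hx hy hR₁ hR₂
  obtain ⟨j, hj, l, hl, hcoords⟩ := exists_hasLatticeCoords hx hy hR₁ hR₂
  have hnorm := hcoords.norm_planeInverse_sub hpos hlt
  rw [entryExpansion] at hnorm
  exact hnorm.trans_le (hm j l (Finset.mk_mem_product hj hl))
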